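/- Work in canonical LF. Expressions are kinds $K ::= \mathsf{type} \mid \Pi x{:}A.K$, type families $A,B ::= u \mid \Pi x{:}A.B \mid \lambda x{:}A.B \mid A\,M$ and objects $M,N ::= x \mid \lambda x.M \mid M\,N$ (an object abstraction carries no type label: in a canonical object the label is determined by the type). Contexts are lists of declarations $x:A$ and $u:K$. Assertions are $\vdash\Gamma\ \mathsf{ctx}$, $\Gamma\vdash K\ \mathsf{kind}$, $\Gamma\vdash A:K$, $\Gamma\vdash M:A$. They are derived by the usual LF rules for contexts, for $\mathsf{type}$, for $\Pi$ and for $\lambda$, together with the backchaining rule: if $(y:\Pi z_1{:}C_1\ldots\Pi z_m{:}C_m.P)\in\Gamma$ with $P$ a base type $u\,\vec L$, and $\Gamma\vdash M_j : C_j[M_1/z_1,\ldots,M_{j-1}/z_{j-1}]$ for all $j$, then $\Gamma\vdash y\,M_1\ldots M_m : P[M_1/z_1,\ldots,M_m/z_m]$; and in the same way $\Gamma\vdash u\,\vec M:\mathsf{type}$ for $(u:\Pi z_1{:}C_1\ldots\Pi z_m{:}C_m.\mathsf{type})\in\Gamma$. In these rules and below, an expression obtained by substitution stands for its $\beta$-normal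 form, and asserting a judgment about it includes that this normal form exists. Rigid occurrence in objects, $X;\delta;x\vdash M$, is defined inductively by: (i) $X;\delta;x\vdash x\,y_1\ldots y_m$ if the $y_j$ are distinct elements of $\delta$ (each possibly written in $\eta$-expanded form); (ii) $X;\delta;x\vdash y\,\vec M$ if $y\notin X$ and $X;\delta;x\vdash M_j$ for some $j$; (iii) $X;\delta;x\vdash\lambda y.M$ if $X;\delta,y;x\vdash M$. Rigid occurrence in types, $X;x\vdash A$, is defined by: $X;x\vdash c\,\vec M$ if $X;\cdot;x\vdash M_j$ for some $j$; and $X;x\vdash\Pi y{:}A.B$ if $X,y;x\vdash B$. **Theorem.** Let $\Gamma,\Delta$ be contexts, $x_1,\ldots,x_n$ variables, $B_1,\ldots,B_n$ types, $A$ a type (for example a base type), and let $N_1,\ldots,N_n$ be objects with free variables in $\mathrm{dom}(\Gamma)$, where each $N_j$ is in $\beta\eta$-long form for the arity of $B_j$. (The arity of a type is the simple type obtained by erasing dependencies and identifying all base types; nothing else is assumed about the type of $N_j$.) Let $1\le i\le n$ and suppose that 1. $x_1,\ldots,x_n;\,x_i\vdash A$, 2. $\Gamma,\,x_1{:}B_1,\ldots,x_n{:}B_n,\,\Delta\vdash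 A:\mathsf{type}$ is derivable, and 3. $\Gamma,\,\Delta[N_1/x_1,\ldots,N_n/x_n]\vdash A[N_1/x_1,\ldots,N_n/x_n]:\mathsf{type}$ is derivable. Then $\Gamma\vdash N_i : B_i[N_1/x_1,\ldots,N_{i-1}/x_{i-1}]$ is derivable. -/

import Mathlib

namespace CanonicalLF

/-! ### Expressions

Object variables are de Bruijn indices. Type variables are never bound inside an expression, so they
are plain names (natural numbers). Objects are those of canonical LF: the type label of an
abstraction is determined by the type the abstraction is checked against, so it is not written. -/

/-- Objects `M ::= x | λx. M | M N`. -/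
inductive Obj : Type
  | var (x : ℕ) : Obj
  | lam (M : Obj) : Obj
  | app (M N : Obj) : Obj

/-- Types and type families `A ::= u | Πx:A. B | λx:A. B | A M`. -/
inductive Fam : Type
  | con (u : ℕ) : Fam
  | pi (A B : Fam) : Fam
  | lam (A B : Fam) : Fam
  | app (A : Fam) (M : Obj) : Fam

/-- Kinds `K ::= type | Πx:A. K`. -/
inductive Kind : Type
  | type : Kind
  | pi (A : Fam) (K : Kind) : Kind

/-! ### Renaming and simultaneous (capture-avoiding) substitution -/

/-- Extend a renaming under a binder. -/
def upRen (ρ : ℕ → ℕ) : ℕ → ℕ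
  | 0 => 0
  | n + 1 => ρ n + 1

def Obj.rename (ρ : ℕ → ℕ) : Obj → Obj
  | .var x => .var (ρ x)
  | .lam M => .lam (M.rename (upRen ρ))
  | .app M N => .app (M.rename ρ) (N.rename ρ)

def Fam.rename (ρ : ℕ → ℕ) : Fam → Fam
  | .con u => .con u
  | .pi A B => .pi (A.rename ρ) (B.rename (upRen ρ))
  | .lam A B => .lam (A.rename ρ) (B.rename (upRen ρ))
  | .app A M => .app (A.rename ρ) (M.rename ρ)

def Kind.rename (ρ : ℕ → ℕ) : Kind → Kind
  | .type => .type
  | .pi A K => .pi (A.rename ρ) (K.rename (upRen ρ))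

/-- Extend a substitution under a binder. -/
def up (σ : ℕ → Obj) : ℕ → Obj
  | 0 => .var 0
  | n + 1 => (σ n).rename Nat.succ

/-- Extend a substitution under `k` binders. -/
def ups : ℕ → (ℕ → Obj) → (ℕ → Obj)
  | 0, σ => σ
  | k + 1, σ => up (ups k σ)

def Obj.subst (σ : ℕ → Obj) : Obj → Obj
  | .var x => σ x
  | .lam M => .lam (M.subst (up σ))
  | .app M N => .app (M.subst σ) (N.subst σ)

def Fam.subst (σ : ℕ → Obj) : Fam → Fam
  | .con u => .con u
  | .pi A B => .pi (A.subst σ) (B.subst (up σ))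
  | .lam A B => .lam (A.subst σ) (B.subst (up σ))
  | .app A M => .app (A.subst σ) (M.subst σ)

def Kind.subst (σ : ℕ → Obj) : Kind → Kind
  | .type => .type
  | .pi A K => .pi (A.subst σ) (K.subst (up σ))

/-- The simultaneous substitution `[N₁/x₁, …, Nₘ/xₘ]` for the `m` innermost variables, listed from
the outermost `x₁` to the innermost `xₘ` (which has index `0`). The other variables are kept. -/
def inst (Ns : List Obj) : ℕ → Obj :=
  fun n => Ns.reverse.getD n (.var (n - Ns.length))

/-! ### Iterated constructors -/

/-- `M N₁ … Nₘ` -/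
def Obj.apps (M : Obj) (Ns : List Obj) : Obj := Ns.foldl .app M

/-- `λx₁. … λxₖ. M` -/
def Obj.lams : ℕ → Obj → Obj
  | 0, M => M
  | k + 1, M => .lam (Obj.lams k M)

/-- `A N₁ … Nₘ` -/
def Fam.apps (A : Fam) (Ns : List Obj) : Fam := Ns.foldl .app A

/-- `Πx₁:B₁. … Πxₘ:Bₘ. A` -/
def Fam.pis (Bs : List Fam) (A : Fam) : Fam := Bs.foldr .pi A

/-- `Πx₁:B₁. … Πxₘ:Bₘ. K` -/
def Kind.pis (Bs : List Fam) (K : Kind) : Kind := Bs.foldr .pi K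

/-- Base types `u M₁ … Mₘ`. -/
def Fam.IsBase (A : Fam) : Prop := ∃ u Ms, A = (Fam.con u).apps Ms

/-! ### Beta reduction and normal forms -/

inductive Obj.Step : Obj → Obj → Prop
  | beta (M N : Obj) : Obj.Step (.app (.lam M) N) (M.subst (inst [N]))
  | lam {M M' : Obj} : Obj.Step M M' → Obj.Step (.lam M) (.lam M')
  | appL {M M' : Obj} (N : Obj) : Obj.Step M M' → Obj.Step (.app M N) (.app M' N)
  | appR (M : Obj) {N N' : Obj} : Obj.Step N N' → Obj.Step (.app M N) (.app M N')

inductive Fam.Step : Fam → Fam → Prop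
  | beta (A B : Fam) (N : Obj) : Fam.Step (.app (.lam A B) N) (B.subst (inst [N]))
  | piL {A A' : Fam} (B : Fam) : Fam.Step A A' → Fam.Step (.pi A B) (.pi A' B)
  | piR (A : Fam) {B B' : Fam} : Fam.Step B B' → Fam.Step (.pi A B) (.pi A B')
  | lamL {A A' : Fam} (B : Fam) : Fam.Step A A' → Fam.Step (.lam A B) (.lam A' B)
  | lamR (A : Fam) {B B' : Fam} : Fam.Step B B' → Fam.Step (.lam A B) (.lam A B')
  | appL {A A' : Fam} (M : Obj) : Fam.Step A A' → Fam.Step (.app A M) (.app A' M)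
  | appR (A : Fam) {M M' : Obj} : Obj.Step M M' → Fam.Step (.app A M) (.app A M')

inductive Kind.Step : Kind → Kind → Prop
  | piL {A A' : Fam} (K : Kind) : Fam.Step A A' → Kind.Step (.pi A K) (.pi A' K)
  | piR (A : Fam) {K K' : Kind} : Kind.Step K K' → Kind.Step (.pi A K) (.pi A K')

/-- `Fam.NF A A'`: the beta normal form of `A` exists and is `A'`. -/
def Fam.NF (A A' : Fam) : Prop :=
  Relation.ReflTransGen Fam.Step A A' ∧ ∀ A'', ¬ Fam.Step A' A''

/-- `Kind.NF K K'`: the beta normal form of `K` exists and is `K'`. -/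
def Kind.NF (K K' : Kind) : Prop :=
  Relation.ReflTransGen Kind.Step K K' ∧ ∀ K'', ¬ Kind.Step K' K''

/-! ### Contexts -/

/-- Declarations `x : A` and `u : K`. -/
inductive Decl : Type
  | obj (A : Fam) : Decl
  | fam (u : ℕ) (K : Kind) : Decl

/-- Contexts, the most recent declaration first; so `Γ, Δ` is `Δ ++ Γ`. -/
abbrev Ctx : Type := List Decl

/-- `Ctx.HasObj Γ x A` is `(x : A) ∈ Γ`, with `A` read in the whole of `Γ`. -/
inductive Ctx.HasObj : Ctx → ℕ → Fam → Prop
  | here (Γ : Ctx) (A : Fam) : Ctx.HasObj (.obj A :: Γ) 0 (A.rename Nat.succ)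
  | there_obj {Γ : Ctx} {x : ℕ} {A : Fam} (B : Fam) :
      Ctx.HasObj Γ x A → Ctx.HasObj (.obj B :: Γ) (x + 1) (A.rename Nat.succ)
  | there_fam {Γ : Ctx} {x : ℕ} {A : Fam} (u : ℕ) (K : Kind) :
      Ctx.HasObj Γ x A → Ctx.HasObj (.fam u K :: Γ) x A

/-- `Ctx.HasFam Γ u K` is `(u : K) ∈ Γ`, with `K` read in the whole of `Γ`. -/
inductive Ctx.HasFam : Ctx → ℕ → Kind → Prop
  | here (Γ : Ctx) (u : ℕ) (K : Kind) : Ctx.HasFam (.fam u K :: Γ) u K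
  | there_obj {Γ : Ctx} {u : ℕ} {K : Kind} (B : Fam) :
      Ctx.HasFam Γ u K → Ctx.HasFam (.obj B :: Γ) u (K.rename Nat.succ)
  | there_fam {Γ : Ctx} {u : ℕ} {K : Kind} (v : ℕ) (L : Kind) :
      Ctx.HasFam Γ u K → Ctx.HasFam (.fam v L :: Γ) u K

/-- The number of object variables that a context declares. -/
def Ctx.numObj : Ctx → ℕ
  | [] => 0
  | .obj _ :: Γ => Ctx.numObj Γ + 1
  | .fam _ _ :: Γ => Ctx.numObj Γ

/-- The context `x₁ : B₁, …, xₘ : Bₘ`. -/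
def Ctx.ofTypes (Bs : List Fam) : Ctx := (Bs.map Decl.obj).reverse

/-- Substitution in a context `Δ` that follows the variables on which `σ` acts. -/
def Ctx.subst (σ : ℕ → Obj) : Ctx → Ctx
  | [] => []
  | .obj A :: Δ => .obj (A.subst (ups (Ctx.numObj Δ) σ)) :: Ctx.subst σ Δ
  | .fam u K :: Δ => .fam u (K.subst (ups (Ctx.numObj Δ) σ)) :: Ctx.subst σ Δ

inductive Decl.NF : Decl → Decl → Prop
  | obj {A A' : Fam} : Fam.NF A A' → Decl.NF (.obj A) (.obj A')
  | fam (u : ℕ) {K K' : Kind} : Kind.NF K K' → Decl.NF (.fam u K) (.fam u K')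

/-- `Ctx.NF Δ Δ'`: the declarations of `Δ'` are the normal forms of those of `Δ`. -/
def Ctx.NF (Δ Δ' : Ctx) : Prop := List.Forall₂ Decl.NF Δ Δ'

/-! ### Derivations of canonical LF -/

/-- The four forms of assertion: `Γ ctx`, `Γ ⊢ K kind`, `Γ ⊢ A : K` and `Γ ⊢ M : A`. -/
inductive Judgment : Type
  | ctx (Γ : Ctx) : Judgment
  | kind (Γ : Ctx) (K : Kind) : Judgment
  | fam (Γ : Ctx) (A : Fam) (K : Kind) : Judgment
  | obj (Γ : Ctx) (M : Obj) (A : Fam) : Judgment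

/-- Derivability in canonical LF. In the two backchaining rules `appFam` and `appObj`, `Cs j` is the
normal form of the type of the argument at position `j`, in which the earlier arguments have been
substituted. -/
inductive Derivable : Judgment → Prop
  | nullCtx : Derivable (.ctx [])
  | kindCtx {Γ : Ctx} {K : Kind} (u : ℕ) :
      Derivable (.kind Γ K) → Derivable (.ctx Γ) → (∀ L, ¬ Ctx.HasFam Γ u L) →
      Derivable (.ctx (.fam u K :: Γ))
  | typeCtx {Γ : Ctx} {A : Fam} :
      Derivable (.fam Γ A .type) → Derivable (.ctx Γ) → Derivable (.ctx (.obj A :: Γ))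
  | typeKind {Γ : Ctx} : Derivable (.ctx Γ) → Derivable (.kind Γ .type)
  | piKind {Γ : Ctx} {A : Fam} {K : Kind} :
      Derivable (.fam Γ A .type) → Derivable (.kind (.obj A :: Γ) K) →
      Derivable (.kind Γ (.pi A K))
  | piFam {Γ : Ctx} {A B : Fam} :
      Derivable (.fam Γ A .type) → Derivable (.fam (.obj A :: Γ) B .type) →
      Derivable (.fam Γ (.pi A B) .type)
  | absFam {Γ : Ctx} {A B : Fam} {K : Kind} :
      Derivable (.fam Γ A .type) → Derivable (.fam (.obj A :: Γ) B K) →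
      Derivable (.fam Γ (.lam A B) (.pi A K))
  | appFam {Γ : Ctx} {u : ℕ} {Bs : List Fam} {Ms : List Obj} (Cs : ℕ → Fam) :
      Derivable (.ctx Γ) → Ctx.HasFam Γ u (Kind.pis Bs .type) → Ms.length = Bs.length →
      (∀ (j : ℕ) (_ : j < Ms.length) (h : j < Bs.length),
        Fam.NF (Bs[j].subst (inst (Ms.take j))) (Cs j)) →
      (∀ (j : ℕ) (h : j < Ms.length), Derivable (.obj Γ Ms[j] (Cs j))) →
      Derivable (.fam Γ ((Fam.con u).apps Ms) .type)
  | absObj {Γ : Ctx} {A B : Fam} {M : Obj} :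
      Derivable (.fam Γ A .type) → Derivable (.obj (.obj A :: Γ) M B) →
      Derivable (.obj Γ (.lam M) (.pi A B))
  | appObj {Γ : Ctx} {y : ℕ} {Bs : List Fam} {P Q : Fam} {Ms : List Obj} (Cs : ℕ → Fam) :
      Derivable (.ctx Γ) → Ctx.HasObj Γ y (Fam.pis Bs P) → P.IsBase → Ms.length = Bs.length →
      (∀ (j : ℕ) (_ : j < Ms.length) (h : j < Bs.length),
        Fam.NF (Bs[j].subst (inst (Ms.take j))) (Cs j)) →
      (∀ (j : ℕ) (h : j < Ms.length), Derivable (.obj Γ Ms[j] (Cs j))) →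
      Fam.NF (P.subst (inst Ms)) Q →
      Derivable (.obj Γ ((Obj.var y).apps Ms) Q)

/-! ### Objects in beta-eta-long form

Whether an object is eta-long depends only on the arities (simple types over a single base type) of
its free variables and of the object. All dependencies are erased: nothing is said about which
types the object and its subterms have. -/

inductive Arity : Type
  | base : Arity
  | arr (a b : Arity) : Arity

def Fam.arity : Fam → Arity
  | .pi A B => .arr A.arity B.arity
  | _ => .base

/-- The arities of the object variables that a context declares, in the order of the indices. -/
def Ctx.arities : Ctx → List Arity
  | [] => []
  | .obj A :: Γ => A.arity :: Ctx.arities Γ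
  | .fam _ _ :: Γ => Ctx.arities Γ

/-- `Obj.Long Θ M a`: the object `M`, with free variables among those of `Θ`, is in beta-eta-long
form for the arity `a`. -/
inductive Obj.Long : List Arity → Obj → Arity → Prop
  | lam {Θ : List Arity} {M : Obj} {a b : Arity} :
      Obj.Long (a :: Θ) M b → Obj.Long Θ (.lam M) (.arr a b)
  | app {Θ : List Arity} {y : ℕ} {as : List Arity} {Ms : List Obj} :
      Θ[y]? = some (as.foldr .arr .base) → Ms.length = as.length →
      (∀ (j : ℕ) (h₁ : j < Ms.length) (h₂ : j < as.length), Obj.Long Θ Ms[j] as[j]) →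
      Obj.Long Θ ((Obj.var y).apps Ms) .base

/-! ### Rigid occurrences -/

/-- `EtaVar y M`: `M` is the variable `y` up to eta-expansion, that is `M` is
`λz₁. … λzₖ. y M₁ … Mₖ` where `Mⱼ` is in turn `zⱼ` up to eta-expansion (`k = 0` gives `y` itself).
In eta-long form this is how a variable is written when it is an argument. -/
inductive EtaVar : ℕ → Obj → Prop
  | mk (y : ℕ) (Ms : List Obj) :
      (∀ (j : ℕ) (h : j < Ms.length), EtaVar (Ms.length - 1 - j) Ms[j]) →
      EtaVar y (Obj.lams Ms.length ((Obj.var (y + Ms.length)).apps Ms))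

/-- `RigidObj X δ x M` is the judgment `X; δ; x ⊢ M`: the variable `x` occurs rigidly in `M`, where
`X` are the variables open to instantiation and `δ` the variables bound on the way. -/
inductive RigidObj : Set ℕ → Set ℕ → ℕ → Obj → Prop
  | init {X δ : Set ℕ} {x : ℕ} (ys : List ℕ) (Ms : List Obj) :
      ys.Nodup → (∀ y ∈ ys, y ∈ δ) → List.Forall₂ EtaVar ys Ms →
      RigidObj X δ x ((Obj.var x).apps Ms)
  | app {X δ : Set ℕ} {x y : ℕ} {M : Obj} (Ms : List Obj) :
      y ∉ X → M ∈ Ms → RigidObj X δ x M → RigidObj X δ x ((Obj.var y).apps Ms)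
  | abs {X δ : Set ℕ} {x : ℕ} {M : Obj} :
      RigidObj (Nat.succ '' X) (insert 0 (Nat.succ '' δ)) (x + 1) M →
      RigidObj X δ x (.lam M)

/-- `RigidFam X x A` is the judgment `X; x ⊢ A`: the variable `x` occurs rigidly in the target of
the type `A`. -/
inductive RigidFam : Set ℕ → ℕ → Fam → Prop
  | app {X : Set ℕ} {x : ℕ} {M : Obj} (c : ℕ) (Ms : List Obj) :
      M ∈ Ms → RigidObj X ∅ x M → RigidFam X x ((Fam.con c).apps Ms)
  | pi {X : Set ℕ} {x : ℕ} (A : Fam) {B : Fam} :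
      RigidFam (insert 0 (Nat.succ '' X)) (x + 1) B → RigidFam X x (.pi A B)

end CanonicalLF

namespace CanonicalLF

/-! ### Substitution algebra -/

/-! The heads met on the way to the rigid occurrence of `x_i` in `A` are never instantiated, so this
path survives the substitution. It is followed in the derivation for `A` and in the derivation for
its instance at once. The invariant is that on the instance side the local context, the current
object and its type are reducts of the instances of those on the abstract side. It passes to
arguments because an uninstantiated head is declared on the instance side with a reduct of the
instance of its type (`Ctx.Red.hasObj`, `Ctx.Red.hasFam`), and confluence then relates the dependent
argument types (`Spine.exists_instance`).

At the end of the path, one side types `x_i y_1 … y_m` and the other the normal form of `N_i y_1 …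
y_m`. The `y_j` are distinct bound variables, so applying `N_i = λz_1 … z_m. R` to them only renames
each `z_j` in `R` to `y_j`. An eta-expanded variable can only have its declared type
(`EtaVar.hasObj`), so `y_j` is declared on the instance side with the type that the instance of
`B_i` demands of `z_j`. Hence the renamed `R` is well typed at the right type. Typing is reflected
by injective renamings (`Derivable.of_rename`), which removes the local context and types `R` over
`Γ, z_1, …, z_m`; abstraction gives `N_i` (`Derivable.of_pattern`). `RigidObj.derivable` and
`RigidFam.derivable` assemble the argument.

As nothing is known about the types of the `N_j`, the existence of normal forms has to come from
arities. Hereditary substitution terminates because the arities of the substituted variables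
decrease (`Obj.Long.subst`), and it applies because everything derivable is long (`Derivable.long`).
The same measure shows that substituting eta-expanded variables amounts to renaming
(`Obj.Long.subst_eta`). -/

def scons (M : Obj) (σ : ℕ → Obj) : ℕ → Obj
  | 0 => M
  | n + 1 => σ n

theorem inst_singleton (M : Obj) : inst [M] = scons M .var := by
  funext n; cases n <;> simp [inst, scons]

theorem upRen_comp (ρ ρ' : ℕ → ℕ) : (fun x => upRen ρ' (upRen ρ x)) = upRen (fun x => ρ' (ρ x)) := by
  funext n; cases n <;> rfl

theorem up_var (ρ : ℕ → ℕ) : up (fun x => .var (ρ x)) = fun x => .var (upRen ρ x) := by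
  funext n; cases n <;> rfl

theorem up_var_id : up Obj.var = Obj.var := by
  funext n; cases n <;> rfl

theorem up_comp_upRen (σ : ℕ → Obj) (ρ : ℕ → ℕ) :
    (fun x => up σ (upRen ρ x)) = up (fun x => σ (ρ x)) := by
  funext n; cases n <;> rfl

namespace Obj

theorem rename_rename (M : Obj) (ρ ρ' : ℕ → ℕ) :
    (M.rename ρ).rename ρ' = M.rename (fun x => ρ' (ρ x)) := by
  induction M generalizing ρ ρ' with
  | var x => rfl
  | lam M ih => simp [rename, ih, upRen_comp]
  | app M N ih₁ ih₂ => simp [rename, ih₁, ih₂]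

theorem rename_eq_subst (M : Obj) (ρ : ℕ → ℕ) : M.rename ρ = M.subst (fun x => .var (ρ x)) := by
  induction M generalizing ρ with
  | var x => rfl
  | lam M ih => simp [rename, subst, ih, up_var]
  | app M N ih₁ ih₂ => simp [rename, subst, ih₁, ih₂]

theorem rename_subst (M : Obj) (ρ : ℕ → ℕ) (σ : ℕ → Obj) :
    (M.rename ρ).subst σ = M.subst (fun x => σ (ρ x)) := by
  induction M generalizing ρ σ with
  | var x => rfl
  | lam M ih => simp [rename, subst, ih, up_comp_upRen]
  | app M N ih₁ ih₂ => simp [rename, subst, ih₁, ih₂]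

end Obj

theorem rename_comp_up (σ : ℕ → Obj) (ρ : ℕ → ℕ) :
    (fun x => (up σ x).rename (upRen ρ)) = up (fun x => (σ x).rename ρ) := by
  funext n; cases n <;> simp [up, upRen, Obj.rename, Obj.rename_rename]

namespace Obj

theorem subst_rename (M : Obj) (σ : ℕ → Obj) (ρ : ℕ → ℕ) :
    (M.subst σ).rename ρ = M.subst (fun x => (σ x).rename ρ) := by
  induction M generalizing ρ σ with
  | var x => rfl
  | lam M ih => simp [rename, subst, ih, rename_comp_up]
  | app M N ih₁ ih₂ => simp [rename, subst, ih₁, ih₂]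

end Obj

theorem subst_comp_up (σ τ : ℕ → Obj) :
    (fun x => (up σ x).subst (up τ)) = up (fun x => (σ x).subst τ) := by
  funext n; cases n <;> simp [up, Obj.subst, Obj.rename_subst, Obj.subst_rename]

namespace Obj

theorem subst_subst (M : Obj) (σ τ : ℕ → Obj) :
    (M.subst σ).subst τ = M.subst (fun x => (σ x).subst τ) := by
  induction M generalizing σ τ with
  | var x => rfl
  | lam M ih => simp [subst, ih, subst_comp_up]
  | app M N ih₁ ih₂ => simp [subst, ih₁, ih₂]

theorem subst_var (M : Obj) : M.subst .var = M := by
  induction M with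
  | var x => rfl
  | lam M ih => simp [subst, ih, up_var_id]
  | app M N ih₁ ih₂ => simp [subst, ih₁, ih₂]

theorem rename_id (M : Obj) : M.rename (fun x => x) = M := by
  rw [rename_eq_subst]; exact M.subst_var

theorem subst_up_inst (M N : Obj) (σ : ℕ → Obj) :
    (M.subst (up σ)).subst (inst [N]) = M.subst (scons N σ) := by
  rw [subst_subst, inst_singleton]
  congr 1; funext n
  cases n with
  | zero => rfl
  | succ n => simp only [up, rename_subst, scons]; exact subst_var _

/-- The substitution lemma for one variable: it makes beta steps stable under substitution. -/
theorem subst_inst_subst (M N : Obj) (σ : ℕ → Obj) :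
    (M.subst (inst [N])).subst σ = (M.subst (up σ)).subst (inst [N.subst σ]) := by
  rw [subst_up_inst, subst_subst, inst_singleton]
  congr 1; funext n; cases n <;> rfl

theorem rename_upRen_inst (M N : Obj) (ρ : ℕ → ℕ) :
    (M.rename (upRen ρ)).subst (inst [N]) = M.subst (scons N (fun x => .var (ρ x))) := by
  rw [rename_eq_subst, ← up_var, subst_up_inst]

theorem rename_inst (M N : Obj) (ρ : ℕ → ℕ) :
    (M.subst (inst [N])).rename ρ = (M.rename (upRen ρ)).subst (inst [N.rename ρ]) := by
  simp only [rename_eq_subst, subst_inst_subst, up_var]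

theorem rename_succ_inst (M N : Obj) : (M.rename Nat.succ).subst (inst [N]) = M := by
  rw [rename_subst, inst_singleton]; exact M.subst_var

/-! ### Objects applied to lists of arguments -/

theorem subst_apps (M : Obj) (Ms : List Obj) (σ : ℕ → Obj) :
    (M.apps Ms).subst σ = (M.subst σ).apps (Ms.map (subst σ)) := by
  induction Ms generalizing M with
  | nil => rfl
  | cons N Ms ih => simpa [apps, subst] using ih (M.app N)

theorem rename_apps (M : Obj) (Ms : List Obj) (ρ : ℕ → ℕ) :
    (M.apps Ms).rename ρ = (M.rename ρ).apps (Ms.map (rename ρ)) := by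
  induction Ms generalizing M with
  | nil => rfl
  | cons N Ms ih => simpa [apps, rename] using ih (M.app N)

theorem apps_append_singleton (M N : Obj) (Ms : List Obj) :
    M.apps (Ms ++ [N]) = (M.apps Ms).app N := by
  simp [apps]

theorem apps_var_ne_lam (y : ℕ) (Ms : List Obj) (M : Obj) : (var y).apps Ms ≠ lam M := by
  induction Ms using List.reverseRecOn with
  | nil => simp [apps]
  | append_singleton Ms N _ => simp [apps_append_singleton]

theorem apps_var_inj {y y' : ℕ} {Ms Ms' : List Obj} (h : (var y).apps Ms = (var y').apps Ms') :
    y = y' ∧ Ms = Ms' := by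
  induction Ms using List.reverseRecOn generalizing Ms' with
  | nil =>
    cases Ms' using List.reverseRecOn with
    | nil => simpa [apps] using h
    | append_singleton Ms' N' => simp [apps_append_singleton] at h; simp [apps] at h
  | append_singleton Ms N ih =>
    cases Ms' using List.reverseRecOn with
    | nil => simp [apps_append_singleton] at h; simp [apps] at h
    | append_singleton Ms' N' =>
      simp only [apps_append_singleton, app.injEq] at h
      obtain ⟨rfl, rfl⟩ := ih h.1
      simp [h.2]

theorem rename_injective {ρ : ℕ → ℕ} (hρ : Function.Injective ρ) :
    Function.Injective (rename ρ) := by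
  intro M
  induction M generalizing ρ with
  | var x => intro N h; cases N <;> simp [rename] at h ⊢; exact hρ h
  | lam M ih =>
    intro N h
    cases N <;> simp only [rename, lam.injEq, reduceCtorEq] at h ⊢
    refine ih (ρ := upRen ρ) ?_ h
    intro a b hab
    cases a <;> cases b <;> simp [upRen] at hab ⊢
    exact hρ hab
  | app M N ih₁ ih₂ =>
    intro L h
    cases L <;> simp only [rename, app.injEq, reduceCtorEq] at h ⊢
    exact ⟨ih₁ hρ h.1, ih₂ hρ h.2⟩

/-- A renamed application of a variable comes from an application of a variable. -/
theorem apps_eq_rename {ρ : ℕ → ℕ} {M : Obj} {y : ℕ} {Ms : List Obj}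
    (h : M.rename ρ = (var y).apps Ms) :
    ∃ x Ns, M = (var x).apps Ns ∧ ρ x = y ∧ Ms = Ns.map (rename ρ) := by
  induction Ms using List.reverseRecOn generalizing M with
  | nil =>
    cases M <;> simp [apps, rename] at h
    exact ⟨_, [], rfl, h, rfl⟩
  | append_singleton Ms N ih =>
    rw [apps_append_singleton] at h
    cases M with
    | var x => simp [rename] at h
    | lam M => simp [rename] at h
    | app M M' =>
      simp only [rename, app.injEq] at h
      obtain ⟨x, Ns, rfl, hx, rfl⟩ := ih h.1
      exact ⟨x, Ns ++ [M'], by rw [apps_append_singleton], hx, by simp [h.2]⟩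

end Obj

theorem upRen_injective {ρ : ℕ → ℕ} (hρ : Function.Injective ρ) :
    Function.Injective (upRen ρ) := by
  intro a b hab
  cases a <;> cases b <;> simp [upRen] at hab ⊢
  exact hρ hab

namespace Fam

theorem rename_rename (A : Fam) (ρ ρ' : ℕ → ℕ) :
    (A.rename ρ).rename ρ' = A.rename (fun x => ρ' (ρ x)) := by
  induction A generalizing ρ ρ' <;> simp_all [rename, upRen_comp, Obj.rename_rename]

theorem rename_eq_subst (A : Fam) (ρ : ℕ → ℕ) : A.rename ρ = A.subst (fun x => .var (ρ x)) := by
  induction A generalizing ρ <;> simp_all [rename, subst, up_var, Obj.rename_eq_subst]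

theorem rename_subst (A : Fam) (ρ : ℕ → ℕ) (σ : ℕ → Obj) :
    (A.rename ρ).subst σ = A.subst (fun x => σ (ρ x)) := by
  induction A generalizing ρ σ <;> simp_all [rename, subst, up_comp_upRen, Obj.rename_subst]

theorem subst_rename (A : Fam) (σ : ℕ → Obj) (ρ : ℕ → ℕ) :
    (A.subst σ).rename ρ = A.subst (fun x => (σ x).rename ρ) := by
  induction A generalizing ρ σ <;> simp_all [rename, subst, rename_comp_up, Obj.subst_rename]

theorem subst_subst (A : Fam) (σ τ : ℕ → Obj) :
    (A.subst σ).subst τ = A.subst (fun x => (σ x).subst τ) := by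
  induction A generalizing σ τ <;> simp_all [subst, subst_comp_up, Obj.subst_subst]

theorem subst_var (A : Fam) : A.subst .var = A := by
  induction A <;> simp_all [subst, up_var_id, Obj.subst_var]

theorem rename_id (A : Fam) : A.rename (fun x => x) = A := by
  rw [rename_eq_subst]; exact A.subst_var

theorem subst_up_inst (A : Fam) (N : Obj) (σ : ℕ → Obj) :
    (A.subst (up σ)).subst (inst [N]) = A.subst (scons N σ) := by
  rw [subst_subst, inst_singleton]
  congr 1; funext n
  cases n with
  | zero => rfl
  | succ n => simp only [up, Obj.rename_subst, scons]; exact Obj.subst_var _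

theorem subst_inst_subst (A : Fam) (N : Obj) (σ : ℕ → Obj) :
    (A.subst (inst [N])).subst σ = (A.subst (up σ)).subst (inst [N.subst σ]) := by
  rw [subst_up_inst, subst_subst, inst_singleton]
  congr 1; funext n; cases n <;> rfl

theorem rename_upRen_inst (A : Fam) (N : Obj) (ρ : ℕ → ℕ) :
    (A.rename (upRen ρ)).subst (inst [N]) = A.subst (scons N (fun x => .var (ρ x))) := by
  rw [rename_eq_subst, ← up_var, subst_up_inst]

theorem rename_inst (A : Fam) (N : Obj) (ρ : ℕ → ℕ) :
    (A.subst (inst [N])).rename ρ = (A.rename (upRen ρ)).subst (inst [N.rename ρ]) := by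
  simp only [rename_eq_subst, Obj.rename_eq_subst, subst_inst_subst, up_var]

theorem rename_injective {ρ : ℕ → ℕ} (hρ : Function.Injective ρ) :
    Function.Injective (rename ρ) := by
  intro A
  induction A generalizing ρ with
  | con u => intro B h; cases B <;> simp_all [rename]
  | pi A B ih₁ ih₂ | lam A B ih₁ ih₂ =>
    intro C h
    cases C <;> simp only [rename, reduceCtorEq, pi.injEq, lam.injEq] at h ⊢
    exact ⟨ih₁ hρ h.1, ih₂ (upRen_injective hρ) h.2⟩
  | app A M ih =>
    intro C h
    cases C <;> simp only [rename, reduceCtorEq, app.injEq] at h ⊢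
    exact ⟨ih hρ h.1, Obj.rename_injective hρ h.2⟩

theorem arity_subst (A : Fam) (σ : ℕ → Obj) : (A.subst σ).arity = A.arity := by
  induction A generalizing σ <;> simp_all [subst, arity]

theorem arity_rename (A : Fam) (ρ : ℕ → ℕ) : (A.rename ρ).arity = A.arity := by
  rw [rename_eq_subst, arity_subst]

theorem subst_apps (A : Fam) (Ms : List Obj) (σ : ℕ → Obj) :
    (A.apps Ms).subst σ = (A.subst σ).apps (Ms.map (Obj.subst σ)) := by
  induction Ms generalizing A with
  | nil => rfl
  | cons N Ms ih => simpa [apps, subst] using ih (A.app N)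

theorem rename_apps (A : Fam) (Ms : List Obj) (ρ : ℕ → ℕ) :
    (A.apps Ms).rename ρ = (A.rename ρ).apps (Ms.map (Obj.rename ρ)) := by
  induction Ms generalizing A with
  | nil => rfl
  | cons N Ms ih => simpa [apps, rename] using ih (A.app N)

theorem apps_append_singleton (A : Fam) (N : Obj) (Ms : List Obj) :
    A.apps (Ms ++ [N]) = (A.apps Ms).app N := by
  simp [apps]

theorem apps_con_ne_pi (u : ℕ) (Ms : List Obj) (A B : Fam) : (con u).apps Ms ≠ pi A B := by
  induction Ms using List.reverseRecOn with
  | nil => simp [apps]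
  | append_singleton Ms N _ => simp [apps_append_singleton]

theorem apps_con_inj {u u' : ℕ} {Ms Ms' : List Obj} (h : (con u).apps Ms = (con u').apps Ms') :
    u = u' ∧ Ms = Ms' := by
  induction Ms using List.reverseRecOn generalizing Ms' with
  | nil =>
    cases Ms' using List.reverseRecOn with
    | nil => simpa [apps] using h
    | append_singleton Ms' N' => simp [apps_append_singleton] at h; simp [apps] at h
  | append_singleton Ms N ih =>
    cases Ms' using List.reverseRecOn with
    | nil => simp [apps_append_singleton] at h; simp [apps] at h
    | append_singleton Ms' N' =>
      simp only [apps_append_singleton, app.injEq] at h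
      obtain ⟨rfl, rfl⟩ := ih h.1
      simp [h.2]

theorem apps_eq_rename {ρ : ℕ → ℕ} {A : Fam} {u : ℕ} {Ms : List Obj}
    (h : A.rename ρ = (con u).apps Ms) :
    ∃ Ns, A = (con u).apps Ns ∧ Ms = Ns.map (Obj.rename ρ) := by
  induction Ms using List.reverseRecOn generalizing A with
  | nil =>
    cases A <;> simp [apps, rename] at h
    exact ⟨[], by simp [apps, h], rfl⟩
  | append_singleton Ms N ih =>
    rw [apps_append_singleton] at h
    cases A with
    | con x => simp [rename] at h
    | lam M => simp [rename] at h
    | pi M => simp [rename] at h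
    | app M M' =>
      simp only [rename, app.injEq] at h
      obtain ⟨Ns, rfl, rfl⟩ := ih h.1
      exact ⟨Ns ++ [M'], by rw [apps_append_singleton], by simp [h.2]⟩

/-- Base types, defined by recursion. -/
def Atomic : Fam → Prop
  | con _ => True
  | app A _ => A.Atomic
  | _ => False

theorem atomic_iff_isBase {A : Fam} : A.Atomic ↔ A.IsBase := by
  constructor
  · intro h
    induction A with
    | con u => exact ⟨u, [], rfl⟩
    | app A M ih =>
      obtain ⟨u, Ms, rfl⟩ := ih h
      exact ⟨u, Ms ++ [M], by rw [apps_append_singleton]⟩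
    | _ => cases h
  · rintro ⟨u, Ms, rfl⟩
    induction Ms using List.reverseRecOn with
    | nil => trivial
    | append_singleton Ms N ih => rw [apps_append_singleton]; exact ih

theorem atomic_subst {A : Fam} {σ : ℕ → Obj} : (A.subst σ).Atomic ↔ A.Atomic := by
  induction A <;> simp_all [subst, Atomic]

theorem atomic_rename {A : Fam} {ρ : ℕ → ℕ} : (A.rename ρ).Atomic ↔ A.Atomic := by
  rw [rename_eq_subst, atomic_subst]

theorem Atomic.arity {A : Fam} (h : A.Atomic) : A.arity = .base := by
  cases A <;> first | rfl | cases h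

end Fam

/-! ### Kinds as types -/

/-- The kind `Πx₁:A₁. … type` of the constant `u`, written as the type `Πx₁:A₁. … u`. -/
def Kind.toFam (u : ℕ) : Kind → Fam
  | .type => .con u
  | .pi A K => .pi A (K.toFam u)

namespace Kind

theorem toFam_rename (u : ℕ) (K : Kind) (ρ : ℕ → ℕ) :
    (K.rename ρ).toFam u = (K.toFam u).rename ρ := by
  induction K generalizing ρ <;> simp_all [toFam, rename, Fam.rename]

theorem toFam_subst (u : ℕ) (K : Kind) (σ : ℕ → Obj) :
    (K.subst σ).toFam u = (K.toFam u).subst σ := by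
  induction K generalizing σ <;> simp_all [toFam, subst, Fam.subst]

theorem toFam_injective (u : ℕ) : Function.Injective (toFam u) := by
  intro K
  induction K with
  | type => intro L h; cases L <;> simp_all [toFam]
  | pi A K ih =>
    intro L h
    cases L <;> simp only [toFam, reduceCtorEq, Fam.pi.injEq] at h
    rw [h.1, ih h.2]

theorem toFam_pis (u : ℕ) (Bs : List Fam) : (pis Bs .type).toFam u = Fam.pis Bs (.con u) := by
  induction Bs with
  | nil => rfl
  | cons B Bs ih => simpa [pis, Fam.pis, toFam] using ih

/-- An atomic target forces the telescope to exhaust the kind; this recovers the shape that the rule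
`appFam` demands from a spine over the coded kind. -/
theorem eq_pis_of_toFam {u : ℕ} {K : Kind} {Bs : List Fam} {P : Fam} (hP : P.Atomic)
    (h : K.toFam u = Fam.pis Bs P) : K = pis Bs .type ∧ P = .con u := by
  induction Bs generalizing K with
  | nil =>
    cases K with
    | type => exact ⟨rfl, h.symm⟩
    | pi A K => simp only [Fam.pis, List.foldr, toFam] at h; subst h; cases hP
  | cons B Bs ih =>
    cases K with
    | type => simp [Fam.pis, toFam] at h
    | pi A K =>
      simp only [Fam.pis, List.foldr, toFam, Fam.pi.injEq] at h
      obtain ⟨rfl, h₂⟩ := h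
      obtain ⟨rfl, rfl⟩ := ih h₂
      exact ⟨rfl, rfl⟩

end Kind

/-! ### Reduction of objects -/

theorem reflTransGen_map {α β : Type*} {r : α → α → Prop} {s : β → β → Prop} (f : α → β)
    (hf : ∀ a b, r a b → s (f a) (f b)) {a b : α} (h : Relation.ReflTransGen r a b) :
    Relation.ReflTransGen s (f a) (f b) := by
  induction h with
  | refl => exact .refl
  | tail _ h ih => exact ih.tail (hf _ _ h)

namespace Obj

abbrev Red : Obj → Obj → Prop := Relation.ReflTransGen Step

theorem Red.lam {M M' : Obj} (h : Red M M') : Red (.lam M) (.lam M') :=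
  reflTransGen_map Obj.lam (fun _ _ => Step.lam) h

theorem Red.app {M M' N N' : Obj} (h : Red M M') (h' : Red N N') : Red (.app M N) (.app M' N') :=
  (reflTransGen_map (fun M => Obj.app M N) (fun _ _ => Step.appL N) h).trans
    (reflTransGen_map (fun N => Obj.app M' N) (fun _ _ => Step.appR M') h')

theorem Red.apps {M M' : Obj} {Ms Ms' : List Obj} (h : Red M M') (h' : List.Forall₂ Red Ms Ms') :
    Red (M.apps Ms) (M'.apps Ms') := by
  induction h' generalizing M M' with
  | nil => exact h
  | cons h₁ _ ih => exact ih (h.app h₁)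

theorem Step.subst {M M' : Obj} (h : Step M M') (σ : ℕ → Obj) : Step (M.subst σ) (M'.subst σ) := by
  induction h generalizing σ with
  | beta M N => rw [subst_inst_subst]; exact .beta _ _
  | lam _ ih => exact .lam (ih _)
  | appL N _ ih => exact .appL _ (ih _)
  | appR M _ ih => exact .appR _ (ih _)

theorem Step.rename {M M' : Obj} (h : Step M M') (ρ : ℕ → ℕ) :
    Step (M.rename ρ) (M'.rename ρ) := by
  simpa only [rename_eq_subst] using h.subst _

theorem Red.subst {M M' : Obj} (h : Red M M') (σ : ℕ → Obj) : Red (M.subst σ) (M'.subst σ) :=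
  reflTransGen_map _ (fun _ _ h => h.subst σ) h

theorem Red.rename {M M' : Obj} (h : Red M M') (ρ : ℕ → ℕ) : Red (M.rename ρ) (M'.rename ρ) :=
  reflTransGen_map _ (fun _ _ h => h.rename ρ) h

end Obj

theorem red_up {σ σ' : ℕ → Obj} (h : ∀ x, Obj.Red (σ x) (σ' x)) (x : ℕ) :
    Obj.Red (up σ x) (up σ' x) := by
  cases x with
  | zero => exact .refl
  | succ x => exact (h x).rename _

theorem red_scons {M M' : Obj} {σ σ' : ℕ → Obj} (hM : Obj.Red M M')
    (h : ∀ x, Obj.Red (σ x) (σ' x)) (x : ℕ) : Obj.Red (scons M σ x) (scons M' σ' x) := by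
  cases x with
  | zero => exact hM
  | succ x => exact h x

theorem red_inst_singleton {M M' : Obj} (hM : Obj.Red M M') (x : ℕ) :
    Obj.Red (inst [M] x) (inst [M'] x) := by
  rw [inst_singleton, inst_singleton]; exact red_scons hM (fun _ => .refl) x

namespace Obj

theorem red_subst (M : Obj) {σ σ' : ℕ → Obj} (h : ∀ x, Red (σ x) (σ' x)) :
    Red (M.subst σ) (M.subst σ') := by
  induction M generalizing σ σ' with
  | var x => exact h x
  | lam M ih => exact (ih (red_up h)).lam
  | app M N ih₁ ih₂ => exact (ih₁ h).app (ih₂ h)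

/-- Reduction of a renamed object is the renaming of a reduction. -/
theorem Step.of_rename {M N : Obj} {ρ : ℕ → ℕ} (h : Step (M.rename ρ) N) :
    ∃ M', Step M M' ∧ N = M'.rename ρ := by
  generalize hL : M.rename ρ = L at h
  induction h generalizing M ρ with
  | beta P Q =>
    cases M with
    | app M₁ M₂ =>
      cases M₁ with
      | lam M₁ =>
        simp only [Obj.rename, app.injEq, Obj.lam.injEq] at hL
        obtain ⟨rfl, rfl⟩ := hL
        exact ⟨_, .beta _ _, by rw [rename_inst]⟩
      | _ => simp [Obj.rename] at hL
    | _ => simp [Obj.rename] at hL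
  | lam _ ih =>
    cases M with
    | lam M =>
      simp only [Obj.rename, Obj.lam.injEq] at hL
      obtain ⟨M', h, rfl⟩ := ih hL
      exact ⟨_, .lam h, rfl⟩
    | _ => simp [Obj.rename] at hL
  | appL N _ ih =>
    cases M with
    | app M₁ M₂ =>
      simp only [Obj.rename, app.injEq] at hL
      obtain ⟨M', h, rfl⟩ := ih hL.1
      exact ⟨_, .appL M₂ h, by simp [Obj.rename, hL.2]⟩
    | _ => simp [Obj.rename] at hL
  | appR N _ ih =>
    cases M with
    | app M₁ M₂ =>
      simp only [Obj.rename, app.injEq] at hL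
      obtain ⟨M', h, rfl⟩ := ih hL.2
      exact ⟨_, .appR M₁ h, by simp [Obj.rename, hL.1]⟩
    | _ => simp [Obj.rename] at hL

theorem Red.of_rename {M N : Obj} {ρ : ℕ → ℕ} (h : Red (M.rename ρ) N) :
    ∃ M', Red M M' ∧ N = M'.rename ρ := by
  induction h with
  | refl => exact ⟨M, .refl, rfl⟩
  | tail _ h ih =>
    obtain ⟨M', h', rfl⟩ := ih
    obtain ⟨M'', h'', rfl⟩ := h.of_rename
    exact ⟨M'', h'.tail h'', rfl⟩

theorem Red.lam_inv {M N : Obj} (h : Red (.lam M) N) : ∃ M', N = .lam M' ∧ Red M M' := by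
  induction h with
  | refl => exact ⟨M, rfl, .refl⟩
  | tail _ h ih =>
    obtain ⟨M', rfl, h'⟩ := ih
    cases h with
    | lam h => exact ⟨_, rfl, h'.tail h⟩

/-- A variable head creates no redex with its arguments, so reduction stays inside them. -/
theorem Step.apps_var_inv {y : ℕ} {Ms : List Obj} {N : Obj} (h : Step ((var y).apps Ms) N) :
    ∃ Ms', N = (var y).apps Ms' ∧ List.Forall₂ Red Ms Ms' := by
  induction Ms using List.reverseRecOn generalizing N with
  | nil => cases h
  | append_singleton Ms M ih =>
    rw [apps_append_singleton] at h
    generalize hL : (var y).apps Ms = L at h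
    cases h with
    | beta P Q => exact absurd hL (apps_var_ne_lam _ _ _)
    | appL N h =>
      subst hL
      obtain ⟨Ms', rfl, h'⟩ := ih h
      exact ⟨Ms' ++ [M], by rw [apps_append_singleton], List.rel_append h' (.cons .refl .nil)⟩
    | appR N h =>
      subst hL
      refine ⟨Ms ++ [_], by rw [apps_append_singleton], List.rel_append ?_ (.cons (.single h) .nil)⟩
      exact List.forall₂_same.2 fun _ _ => .refl

theorem Step.apps_var_mem {y : ℕ} {Ms : List Obj} {N : Obj} (h : Step ((var y).apps Ms) N) :
    ∃ M ∈ Ms, ∃ M', Step M M' := by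
  induction Ms using List.reverseRecOn generalizing N with
  | nil => cases h
  | append_singleton Ms M ih =>
    rw [apps_append_singleton] at h
    generalize hL : (var y).apps Ms = L at h
    cases h with
    | beta P Q => exact absurd hL (apps_var_ne_lam _ _ _)
    | appL N h =>
      subst hL
      obtain ⟨L, hL, h⟩ := ih h
      exact ⟨L, by simp [hL], h⟩
    | appR N h => exact ⟨M, by simp, _, h⟩

theorem forall₂_red_trans {Ms Ms' Ms'' : List Obj} (h : List.Forall₂ Red Ms Ms')
    (h' : List.Forall₂ Red Ms' Ms'') : List.Forall₂ Red Ms Ms'' := by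
  induction h generalizing Ms'' with
  | nil => exact h'
  | cons h₁ _ ih =>
    cases h' with
    | cons h₂ h₃ => exact .cons (h₁.trans h₂) (ih h₃)

theorem Red.apps_var_inv {y : ℕ} {Ms : List Obj} {N : Obj} (h : Red ((var y).apps Ms) N) :
    ∃ Ms', N = (var y).apps Ms' ∧ List.Forall₂ Red Ms Ms' := by
  induction h with
  | refl => exact ⟨Ms, rfl, List.forall₂_same.2 fun _ _ => .refl⟩
  | tail _ h ih =>
    obtain ⟨Ms', rfl, h'⟩ := ih
    obtain ⟨Ms'', rfl, h''⟩ := h.apps_var_inv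
    exact ⟨Ms'', rfl, forall₂_red_trans h' h''⟩

/-- Parallel reduction. -/
inductive Par : Obj → Obj → Prop
  | var (x : ℕ) : Par (.var x) (.var x)
  | lam {M M' : Obj} : Par M M' → Par (.lam M) (.lam M')
  | app {M M' N N' : Obj} : Par M M' → Par N N' → Par (.app M N) (.app M' N')
  | beta {M M' N N' : Obj} : Par M M' → Par N N' →
      Par (.app (.lam M) N) (M'.subst (inst [N']))

theorem Par.refl (M : Obj) : Par M M := by
  induction M with
  | var x => exact .var x
  | lam M ih => exact .lam ih
  | app M N ih₁ ih₂ => exact .app ih₁ ih₂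

theorem Step.par {M N : Obj} (h : Step M N) : Par M N := by
  induction h with
  | beta M N => exact .beta (.refl _) (.refl _)
  | lam _ ih => exact .lam ih
  | appL N _ ih => exact .app ih (.refl _)
  | appR M _ ih => exact .app (.refl _) ih

theorem Par.red {M N : Obj} (h : Par M N) : Red M N := by
  induction h with
  | var x => exact .refl
  | lam _ ih => exact ih.lam
  | app _ _ ih₁ ih₂ => exact ih₁.app ih₂
  | beta _ _ ih₁ ih₂ => exact (ih₁.lam.app ih₂).tail (.beta _ _)

theorem Par.rename {M N : Obj} (h : Par M N) (ρ : ℕ → ℕ) : Par (M.rename ρ) (N.rename ρ) := by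
  induction h generalizing ρ with
  | var x => exact .var _
  | lam _ ih => exact .lam (ih _)
  | app _ _ ih₁ ih₂ => exact .app (ih₁ _) (ih₂ _)
  | beta _ _ ih₁ ih₂ => rw [rename_inst]; exact .beta (ih₁ _) (ih₂ _)

theorem Par.subst {M N : Obj} (h : Par M N) {σ τ : ℕ → Obj} (hσ : ∀ x, Par (σ x) (τ x)) :
    Par (M.subst σ) (N.subst τ) := by
  have hup : ∀ {σ τ : ℕ → Obj}, (∀ x, Par (σ x) (τ x)) → ∀ x, Par (up σ x) (up τ x) := by
    intro σ τ h x
    cases x with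
    | zero => exact .refl _
    | succ x => exact (h x).rename _
  induction h generalizing σ τ with
  | var x => exact hσ x
  | lam _ ih => exact .lam (ih (hup hσ))
  | app _ _ ih₁ ih₂ => exact .app (ih₁ hσ) (ih₂ hσ)
  | beta _ _ ih₁ ih₂ => rw [subst_inst_subst]; exact .beta (ih₁ (hup hσ)) (ih₂ hσ)

theorem Par.inst {M M' N N' : Obj} (h : Par M M') (h' : Par N N') :
    Par (M.subst (inst [N])) (M'.subst (CanonicalLF.inst [N'])) := by
  refine h.subst fun x => ?_
  rw [inst_singleton, inst_singleton]
  cases x with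
  | zero => exact h'
  | succ x => exact .refl _

/-- The complete development of an object. -/
def dev : Obj → Obj
  | .var x => .var x
  | .lam M => .lam M.dev
  | .app (.lam M) N => M.dev.subst (CanonicalLF.inst [N.dev])
  | .app M N => .app M.dev N.dev

/-- Takahashi's triangle property: the complete development contracts every redex present in `M`, so
whatever a parallel step left undone can be contracted in one more. -/
theorem Par.dev {M N : Obj} (h : Par M N) : Par N M.dev := by
  induction h with
  | var x => exact .var x
  | lam _ ih => exact .lam ih
  | @app M M' N N' h₁ h₂ ih₁ ih₂ =>
    -- An abstraction in function position is a redex that `dev` contracts although this parallel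
    -- step did not.
    cases M with
    | lam M =>
      cases h₁ with
      | lam h₁ =>
        cases ih₁ with
        | lam ih₁ => exact .beta ih₁ ih₂
    | var x => exact .app ih₁ ih₂
    | app M₁ M₂ => exact .app ih₁ ih₂
  | beta _ _ ih₁ ih₂ => exact ih₁.inst ih₂

/-- Parallel reduction lies between one-step and many-step reduction and has the diamond property by
`Par.dev`. -/
theorem Red.confluent {M N L : Obj} (h : Red M N) (h' : Red M L) : ∃ P, Red N P ∧ Red L P := by
  have key : Relation.Join (Relation.ReflTransGen Par) N L := by
    refine Relation.church_rosser (fun a b c hb hc => ⟨a.dev, .single hb.dev, .single hc.dev⟩)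
      (reflTransGen_map id (fun _ _ => Step.par) h) (reflTransGen_map id (fun _ _ => Step.par) h')
  obtain ⟨P, hN, hL⟩ := key
  have : ∀ {a b}, Relation.ReflTransGen Par a b → Red a b := by
    intro a b hab
    induction hab with
    | refl => exact .refl
    | tail _ h ih => exact ih.trans h.red
  exact ⟨P, this hN, this hL⟩

theorem Red.eq_of_normal {M N : Obj} (h : Red M N) (hM : ∀ L, ¬ Step M L) : N = M := by
  cases Relation.ReflTransGen.cases_head h with
  | inl h => exact h.symm
  | inr h => obtain ⟨L, hL, _⟩ := h; exact absurd hL (hM L)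

end Obj

/-! ### Reduction of families without family-level abstractions -/

namespace Fam

/-- Without family-level abstractions all redexes lie inside object arguments, so reduction is
componentwise and confluence is inherited from objects. Every family of kind `type` qualifies
(`Derivable.noLam`). -/
def NoLam : Fam → Prop
  | con _ => True
  | pi A B => A.NoLam ∧ B.NoLam
  | lam _ _ => False
  | app A _ => A.NoLam

/-- Componentwise reduction. -/
inductive Red : Fam → Fam → Prop
  | con (u : ℕ) : Red (.con u) (.con u)
  | pi {A A' B B' : Fam} : Red A A' → Red B B' → Red (.pi A B) (.pi A' B')
  | app {A A' : Fam} {M M' : Obj} : Red A A' → Obj.Red M M' → Red (.app A M) (.app A' M')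

theorem noLam_subst {A : Fam} {σ : ℕ → Obj} : (A.subst σ).NoLam ↔ A.NoLam := by
  induction A generalizing σ <;> simp_all [subst, NoLam]

theorem noLam_rename {A : Fam} {ρ : ℕ → ℕ} : (A.rename ρ).NoLam ↔ A.NoLam := by
  rw [rename_eq_subst, noLam_subst]

theorem noLam_pis {Bs : List Fam} {P : Fam} :
    (pis Bs P).NoLam ↔ (∀ B ∈ Bs, B.NoLam) ∧ P.NoLam := by
  induction Bs with
  | nil => simp [pis]
  | cons B Bs ih =>
    have : pis (B :: Bs) P = .pi B (pis Bs P) := rfl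
    rw [this, NoLam, ih]; simp [and_assoc]

theorem noLam_con_apps (u : ℕ) (Ms : List Obj) : ((con u).apps Ms).NoLam := by
  induction Ms using List.reverseRecOn with
  | nil => trivial
  | append_singleton Ms N ih => rw [apps_append_singleton]; exact ih

theorem NoLam.red_refl {A : Fam} (h : A.NoLam) : Red A A := by
  induction A with
  | con u => exact .con u
  | pi A B ih₁ ih₂ => exact .pi (ih₁ h.1) (ih₂ h.2)
  | lam A B => cases h
  | app A M ih => exact .app (ih h) .refl

theorem Red.noLam_right {A B : Fam} (h : Red A B) : B.NoLam := by
  induction h with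
  | con u => trivial
  | pi _ _ ih₁ ih₂ => exact ⟨ih₁, ih₂⟩
  | app _ _ ih => exact ih

theorem Red.trans {A B C : Fam} (h : Red A B) (h' : Red B C) : Red A C := by
  induction h generalizing C with
  | con u => exact h'
  | pi _ _ ih₁ ih₂ => cases h' with | pi h₁ h₂ => exact .pi (ih₁ h₁) (ih₂ h₂)
  | app _ h ih => cases h' with | app h₁ h₂ => exact .app (ih h₁) (h.trans h₂)

theorem Red.confluent {A B C : Fam} (h : Red A B) (h' : Red A C) : ∃ D, Red B D ∧ Red C D := by
  induction h generalizing C with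
  | con u => cases h'; exact ⟨_, .con u, .con u⟩
  | pi _ _ ih₁ ih₂ =>
    cases h' with
    | pi h₁ h₂ =>
      obtain ⟨D₁, h₁, h₁'⟩ := ih₁ h₁
      obtain ⟨D₂, h₂, h₂'⟩ := ih₂ h₂
      exact ⟨_, .pi h₁ h₂, .pi h₁' h₂'⟩
  | app _ h ih =>
    cases h' with
    | app h₁ h₂ =>
      obtain ⟨D₁, h₁, h₁'⟩ := ih h₁
      obtain ⟨D₂, h₂, h₂'⟩ := h.confluent h₂
      exact ⟨_, .app h₁ h₂, .app h₁' h₂'⟩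

theorem Red.subst {A B : Fam} (h : Red A B) {σ τ : ℕ → Obj} (hσ : ∀ x, Obj.Red (σ x) (τ x)) :
    Red (A.subst σ) (B.subst τ) := by
  induction h generalizing σ τ with
  | con u => exact .con u
  | pi _ _ ih₁ ih₂ => exact .pi (ih₁ hσ) (ih₂ (red_up hσ))
  | app _ h ih => exact .app (ih hσ) ((h.subst σ).trans (Obj.red_subst _ hσ))

theorem Red.rename {A B : Fam} (h : Red A B) (ρ : ℕ → ℕ) : Red (A.rename ρ) (B.rename ρ) := by
  rw [rename_eq_subst, rename_eq_subst]; exact h.subst fun _ => .refl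

theorem Red.of_rename {A B : Fam} {ρ : ℕ → ℕ} (h : Red (A.rename ρ) B) :
    ∃ A', Red A A' ∧ B = A'.rename ρ := by
  induction A generalizing B ρ with
  | con u => cases h; exact ⟨.con u, .con u, rfl⟩
  | pi A₁ A₂ ih₁ ih₂ =>
    cases h with
    | pi h₁ h₂ =>
      obtain ⟨_, h₁', rfl⟩ := ih₁ h₁
      obtain ⟨_, h₂', rfl⟩ := ih₂ h₂
      exact ⟨_, .pi h₁' h₂', rfl⟩
  | lam => cases h
  | app A M ih =>
    cases h with
    | app h₁ h₂ =>
      obtain ⟨_, h₁', rfl⟩ := ih h₁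
      obtain ⟨_, h₂', rfl⟩ := h₂.of_rename
      exact ⟨_, .app h₁' h₂', rfl⟩

theorem Red.arity {A B : Fam} (h : Red A B) : B.arity = A.arity := by
  induction h <;> simp_all [Fam.arity]

theorem Red.atomic {A B : Fam} (h : Red A B) : B.Atomic ↔ A.Atomic := by
  induction h <;> simp_all [Atomic]

theorem Red.con_apps_inv {u : ℕ} {Ms : List Obj} {B : Fam} (h : Red ((Fam.con u).apps Ms) B) :
    ∃ Ms', B = (Fam.con u).apps Ms' ∧ List.Forall₂ Obj.Red Ms Ms' := by
  induction Ms using List.reverseRecOn generalizing B with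
  | nil => cases h; exact ⟨[], rfl, .nil⟩
  | append_singleton Ms M ih =>
    rw [apps_append_singleton] at h
    cases h with
    | app h h' =>
      obtain ⟨Ms', rfl, h₂⟩ := ih h
      exact ⟨Ms' ++ [_], by rw [apps_append_singleton], List.rel_append h₂ (.cons h' .nil)⟩

theorem NoLam.red_of_step {A B : Fam} (hA : A.NoLam) (h : Step A B) : Red A B := by
  induction h with
  | beta => cases hA
  | piL _ _ ih => exact .pi (ih hA.1) hA.2.red_refl
  | piR _ _ ih => exact .pi hA.1.red_refl (ih hA.2)
  | lamL | lamR => cases hA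
  | appL _ _ ih => exact .app (ih hA) .refl
  | appR _ h => exact .app (NoLam.red_refl hA) (.single h)

theorem NoLam.red_of_steps {A B : Fam} (hA : A.NoLam) (h : Relation.ReflTransGen Step A B) :
    Red A B := by
  induction h with
  | refl => exact hA.red_refl
  | tail _ h ih => exact ih.trans (ih.noLam_right.red_of_step h)

theorem Red.steps {A B : Fam} (h : Red A B) : Relation.ReflTransGen Step A B := by
  induction h with
  | con u => exact .refl
  | @pi A A' B B' _ _ ih₁ ih₂ =>
    exact (reflTransGen_map (fun A => Fam.pi A B) (fun _ _ => Step.piL B) ih₁).trans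
      (reflTransGen_map (fun B => Fam.pi A' B) (fun _ _ => Step.piR A') ih₂)
  | @app A A' M M' _ h ih =>
    exact (reflTransGen_map (fun A => Fam.app A M) (fun _ _ => Step.appL M) ih).trans
      (reflTransGen_map (fun M => Fam.app A' M) (fun _ _ => Step.appR A') h)

theorem Red.eq_of_normal {A B : Fam} (h : Red A B) (hA : ∀ C, ¬ Step A C) : B = A := by
  cases Relation.ReflTransGen.cases_head h.steps with
  | inl h => exact h.symm
  | inr h => obtain ⟨L, hL, _⟩ := h; exact absurd hL (hA L)

/-- A reduct of `A` reduces to the normal form of `A`. -/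
theorem Red.to_normal {A B C : Fam} (h : Red A B) (h' : Red A C) (hC : ∀ D, ¬ Step C D) :
    Red B C := by
  obtain ⟨D, h₁, h₂⟩ := h.confluent h'
  rwa [h₂.eq_of_normal hC] at h₁

end Fam

theorem Kind.NF.red {K K' : Kind} (u : ℕ) (h : Kind.NF K K') (hK : (K.toFam u).NoLam) :
    Fam.Red (K.toFam u) (K'.toFam u) := by
  have hstep : ∀ {K K' : Kind}, Kind.Step K K' → Fam.Step (K.toFam u) (K'.toFam u) := by
    intro K K' h
    induction h with
    | piL _ h => exact .piL _ h
    | piR _ _ ih => exact .piR _ ih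
  exact hK.red_of_steps (reflTransGen_map (Kind.toFam u) (fun _ _ => hstep) h.1)

/-! ### Long objects -/

namespace Arity

def size : Arity → ℕ
  | base => 0
  | arr a b => a.size + b.size + 1

/-- The arity `a₁ → … → aₘ → base`. -/
abbrev arrs (as : List Arity) : Arity := as.foldr arr base

theorem size_lt_of_mem {as : List Arity} {a : Arity} (h : a ∈ as) : a.size < (arrs as).size := by
  induction as with
  | nil => cases h
  | cons b as ih =>
    have hs : (arrs (b :: as)).size = b.size + (arrs as).size + 1 := rfl
    rcases List.mem_cons.1 h with rfl | h
    · omega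
    · have := ih h; omega

end Arity

namespace Obj

theorem Long.app_forall₂ {Θ : List Arity} {y : ℕ} {as : List Arity} {Ms : List Obj}
    (hy : Θ[y]? = some (.arrs as)) (h : List.Forall₂ (Long Θ) Ms as) :
    Long Θ ((var y).apps Ms) .base :=
  .app hy h.length_eq fun _ h₁ h₂ => h.get h₁ h₂

theorem forall₂_of_getElem {α β : Type*} {R : α → β → Prop} {l : List α} {l' : List β}
    (hlen : l.length = l'.length)
    (h : ∀ (j : ℕ) (h₁ : j < l.length) (h₂ : j < l'.length), R l[j] l'[j]) :
    List.Forall₂ R l l' :=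
  List.forall₂_iff_get.2 ⟨hlen, h⟩

-- The arguments and their induction hypotheses are packaged in a `List.Forall₂`, in place of the
-- positional premises of `Long.app`.
@[elab_as_elim]
theorem Long.ind {motive : (Θ : List Arity) → (M : Obj) → (a : Arity) → Long Θ M a → Prop}
    (lam : ∀ (Θ : List Arity) (M : Obj) (a b : Arity) (h : Long (a :: Θ) M b),
      motive (a :: Θ) M b h → motive Θ (.lam M) (.arr a b) (.lam h))
    (app : ∀ (Θ : List Arity) (y : ℕ) (as : List Arity) (Ms : List Obj)
      (hy : Θ[y]? = some (.arrs as))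
      (h : List.Forall₂ (fun M a => Long Θ M a ∧ ∀ h, motive Θ M a h) Ms as),
      motive Θ ((var y).apps Ms) .base (.app_forall₂ hy (h.imp fun _ _ h => h.1)))
    {Θ : List Arity} {M : Obj} {a : Arity} (h : Long Θ M a) : motive Θ M a h := by
  induction h with
  | lam h ih => exact lam _ _ _ _ h ih
  | app hy hlen h ih =>
    exact app _ _ _ _ hy
      (forall₂_of_getElem hlen fun j h₁ h₂ => ⟨h j h₁ h₂, fun _ => ih j h₁ h₂⟩)

theorem Long.arr_inv {Θ : List Arity} {M : Obj} {a b : Arity} (h : Long Θ M (.arr a b)) :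
    ∃ N, M = .lam N ∧ Long (a :: Θ) N b := by
  cases h with
  | lam h => exact ⟨_, rfl, h⟩

theorem Long.base_inv {Θ : List Arity} {M : Obj} (h : Long Θ M .base) :
    ∃ y as Ms, M = (var y).apps Ms ∧ Θ[y]? = some (.arrs as) ∧ List.Forall₂ (Long Θ) Ms as := by
  cases h with
  | app hy hlen h => exact ⟨_, _, _, rfl, hy, forall₂_of_getElem hlen h⟩

theorem Long.normal {Θ : List Arity} {M : Obj} {a : Arity} (h : Long Θ M a) (N : Obj) :
    ¬ Step M N := by
  induction h using Long.ind generalizing N with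
  | lam Θ M a b _ ih => rintro (_ | h); exact ih _ h
  | app Θ y as Ms _ h =>
    intro hs
    obtain ⟨M, hM, M', hs⟩ := hs.apps_var_mem
    obtain ⟨j, hj, rfl⟩ := List.mem_iff_getElem.1 hM
    exact (h.get hj (h.length_eq ▸ hj)).2 (h.get hj (h.length_eq ▸ hj)).1 _ hs

theorem Long.rename {Θ Θ' : List Arity} {M : Obj} {a : Arity} (h : Long Θ M a) {ρ : ℕ → ℕ}
    (hρ : ∀ (x : ℕ) (c : Arity), Θ[x]? = some c → Θ'[ρ x]? = some c) :
    Long Θ' (M.rename ρ) a := by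
  induction h using Long.ind generalizing Θ' ρ with
  | lam Θ M a b _ ih =>
    refine .lam (ih fun x c hx => ?_)
    cases x with
    | zero => exact hx
    | succ x => exact hρ x c hx
  | app Θ y as Ms hy h =>
    rw [rename_apps]
    exact .app_forall₂ (hρ _ _ hy) (List.forall₂_map_left_iff.2 (h.imp fun _ _ h => h.2 h.1 hρ))

theorem Long.rename_succ {Θ : List Arity} {M : Obj} {a : Arity} (h : Long Θ M a) (b : Arity) :
    Long (b :: Θ) (M.rename Nat.succ) a :=
  h.rename fun _ _ hx => hx

/-- Hereditary substitution, with the arities of the substituted variables bounded in size. -/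
theorem Long.subst_aux (n : ℕ) {Θ : List Arity} {M : Obj} {b : Arity} (h : Long Θ M b)
    {Θ' : List Arity} {σ : ℕ → Obj}
    (hσ : ∀ (x : ℕ) (c : Arity), Θ[x]? = some c →
      (∃ y, σ x = .var y ∧ Θ'[y]? = some c) ∨ (c.size < n ∧ Long Θ' (σ x) c)) :
    ∃ M', Red (M.subst σ) M' ∧ Long Θ' M' b := by
  induction n using Nat.strong_induction_on generalizing Θ M b Θ' σ with
  | _ n IH =>
  -- Contracting a long function against long arguments substitutes at an argument arity, which is
  -- strictly smaller than the arity of the function, so the hypothesis for smaller bounds applies.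
  have happ : ∀ (as : List Arity) (Θ : List Arity) (N : Obj) (Ms : List Obj),
      (Arity.arrs as).size < n → Long Θ N (.arrs as) → List.Forall₂ (Long Θ) Ms as →
      ∃ M', Red (N.apps Ms) M' ∧ Long Θ M' .base := by
    intro as
    induction as with
    | nil => intro Θ N Ms _ hN hMs; cases hMs; exact ⟨N, .refl, hN⟩
    | cons a as ih =>
      intro Θ N Ms hn hN hMs
      cases hMs with
      | @cons M _ Ms _ hM hMs =>
        obtain ⟨R, rfl, hR⟩ := hN.arr_inv
        have hs : (Arity.arrs (a :: as)).size = a.size + (Arity.arrs as).size + 1 := rfl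
        obtain ⟨N', hN', hL⟩ := IH (a.size + 1) (by omega) hR (Θ' := Θ) (σ := inst [M]) (by
          intro x c hx
          rw [inst_singleton]
          cases x with
          | zero =>
            simp only [List.getElem?_cons_zero, Option.some.injEq] at hx
            subst hx
            exact .inr ⟨by omega, hM⟩
          | succ x => exact .inl ⟨x, rfl, hx⟩)
        obtain ⟨M', hM', hL'⟩ := ih Θ N' Ms (by omega) hL hMs
        refine ⟨M', ?_, hL'⟩
        have : Red ((Obj.app (.lam R) M).apps Ms) (N'.apps Ms) :=
          Red.apps (.head (.beta _ _) hN') (List.forall₂_same.2 fun _ _ => .refl)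
        exact this.trans hM'
  induction h using Long.ind generalizing Θ' σ with
  | lam Θ M a b _ ih =>
    obtain ⟨M', hM', hL⟩ := ih (Θ' := a :: Θ') (σ := up σ) (by
      intro x c hx
      cases x with
      | zero => exact .inl ⟨0, rfl, hx⟩
      | succ x =>
        rcases hσ x c hx with ⟨y, hy, hc⟩ | ⟨hc, hL⟩
        · exact .inl ⟨y + 1, by simp [up, hy, Obj.rename], hc⟩
        · exact .inr ⟨hc, hL.rename_succ _⟩)
    exact ⟨_, hM'.lam, .lam hL⟩
  | app Θ y as Ms hy h =>
    have : ∃ Ms', List.Forall₂ Red (Ms.map (Obj.subst σ)) Ms' ∧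
        List.Forall₂ (Long Θ') Ms' as := by
      clear hy
      induction h with
      | nil => exact ⟨[], .nil, .nil⟩
      | cons h _ ih =>
        obtain ⟨Ms', h₁, h₂⟩ := ih
        obtain ⟨M', h₁', h₂'⟩ := h.2 h.1 hσ
        exact ⟨M' :: Ms', .cons h₁' h₁, .cons h₂' h₂⟩
    obtain ⟨Ms', h₁, h₂⟩ := this
    rw [subst_apps]
    -- A variable of functional arity is not long by itself, so images that are variables form a
    -- separate case; only a substituted long object creates redexes, which `happ` contracts.
    rcases hσ y _ hy with ⟨z, hz, hc⟩ | ⟨hc, hL⟩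
    · exact ⟨(var z).apps Ms', Red.apps (by rw [Obj.subst, hz]) h₁, .app_forall₂ hc h₂⟩
    · obtain ⟨M', hM', hL'⟩ := happ as Θ' _ _ hc hL h₂
      exact ⟨M', (Red.apps .refl h₁).trans hM', hL'⟩

/-- `σ` maps each variable of `Θ` to a variable of `Θ'` of the same arity or to a long object of
that arity. -/
def LongSubst (Θ Θ' : List Arity) (σ : ℕ → Obj) : Prop :=
  ∀ (x : ℕ) (c : Arity), Θ[x]? = some c →
    (∃ y, σ x = .var y ∧ Θ'[y]? = some c) ∨ Long Θ' (σ x) c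

theorem LongSubst.up {Θ Θ' : List Arity} {σ : ℕ → Obj} (hσ : LongSubst Θ Θ' σ) (a : Arity) :
    LongSubst (a :: Θ) (a :: Θ') (up σ) := by
  intro x c hx
  cases x with
  | zero => exact .inl ⟨0, rfl, hx⟩
  | succ x =>
    rcases hσ x c hx with ⟨y, hy, hc⟩ | hL
    · exact .inl ⟨y + 1, by simp [CanonicalLF.up, hy, Obj.rename], hc⟩
    · exact .inr (hL.rename_succ _)

theorem LongSubst.inst {Θ : List Arity} {M : Obj} {a : Arity} (h : Long Θ M a) :
    LongSubst (a :: Θ) Θ (inst [M]) := by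
  intro x c hx
  rw [inst_singleton]
  cases x with
  | zero =>
    simp only [List.getElem?_cons_zero, Option.some.injEq] at hx
    subst hx
    exact .inr h
  | succ x => exact .inl ⟨x, rfl, hx⟩

/-- Hereditary substitution. -/
theorem Long.subst {Θ Θ' : List Arity} {M : Obj} {b : Arity} (h : Long Θ M b) {σ : ℕ → Obj}
    (hσ : LongSubst Θ Θ' σ) : ∃ M', Red (M.subst σ) M' ∧ Long Θ' M' b := by
  have hbound : ∃ n, ∀ c ∈ Θ, c.size < n := by
    clear h hσ
    induction Θ with
    | nil => exact ⟨0, by simp⟩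
    | cons a Θ ih =>
      obtain ⟨n, hn⟩ := ih
      refine ⟨n + a.size + 1, fun c hc => ?_⟩
      rcases List.mem_cons.1 hc with rfl | hc
      · omega
      · have := hn c hc; omega
  obtain ⟨n, hn⟩ := hbound
  refine h.subst_aux n fun x c hx => ?_
  rcases hσ x c hx with h | h
  · exact .inl h
  · exact .inr ⟨hn c (List.mem_of_getElem? hx), h⟩

/-! ### Eta-expansion -/

/-- The eta-expansion of `h` at an arity. -/
def eta : Arity → Obj → Obj
  | .base, h => h
  | .arr a b, h => .lam (eta b (.app (h.rename Nat.succ) (eta a (.var 0))))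

theorem eta_subst (a : Arity) (h : Obj) (σ : ℕ → Obj) :
    (eta a h).subst σ = eta a (h.subst σ) := by
  induction a generalizing h σ with
  | base => rfl
  | arr a b ih₁ ih₂ =>
    simp only [eta, Obj.subst, ih₁, ih₂, up, rename_subst, subst_rename]

theorem eta_rename (a : Arity) (h : Obj) (ρ : ℕ → ℕ) :
    (eta a h).rename ρ = eta a (h.rename ρ) := by
  rw [rename_eq_subst, eta_subst, rename_eq_subst]

theorem Red.eta {h h' : Obj} (hr : Red h h') (a : Arity) : Red (eta a h) (eta a h') := by
  induction a generalizing h h' with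
  | base => exact hr
  | arr a b _ ih => exact (ih ((hr.rename _).app .refl)).lam

/-- Each argument consumes one abstraction of the expansion and gets eta-expanded in passing; the
hypothesis on `Ms` undoes that. -/
theorem eta_apps {as : List Arity} {Ms : List Obj}
    (hM : List.Forall₂ (fun M a => Red (eta a M) M) Ms as) (h : Obj) :
    Red ((eta (.arrs as) h).apps Ms) (h.apps Ms) := by
  induction hM generalizing h with
  | nil => exact .refl
  | @cons M a Ms as hM _ ih =>
    have h₁ : Step ((eta (.arrs (a :: as)) h).app M) (eta (.arrs as) (.app h (eta a M))) := by
      have := Step.beta (eta (.arrs as) (.app (h.rename Nat.succ) (eta a (.var 0)))) M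
      rw [eta_subst] at this
      rw [Obj.subst, rename_succ_inst, eta_subst, Obj.subst, inst_singleton] at this
      exact this
    have h₂ : Red ((eta (.arrs (a :: as)) h).app M) (eta (.arrs as) (.app h M)) :=
      .head h₁ ((Red.app .refl hM).eta _)
    exact (Red.apps h₂ (List.forall₂_same.2 fun _ _ => .refl)).trans (ih (.app h M))

/-- An expanded variable in head position unfolds against its arguments and expands them at strictly
smaller arities, where `H` contracts them again. The hypothesis `H` breaks the mutual dependence
with `Long.red_eta`, resolved there by induction on the size of the arity. -/
theorem Long.subst_eta_aux {n : ℕ}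
    (H : ∀ (Θ : List Arity) (N : Obj) (a : Arity), a.size < n → Long Θ N a → Red (eta a N) N)
    {Θ : List Arity} {M : Obj} {b : Arity} (h : Long Θ M b) {σ : ℕ → Obj} {ρ : ℕ → ℕ}
    (hσ : ∀ (x : ℕ) (c : Arity), Θ[x]? = some c →
      σ x = .var (ρ x) ∨ (c.size ≤ n ∧ σ x = eta c (.var (ρ x)))) :
    Red (M.subst σ) (M.rename ρ) := by
  induction h using Long.ind generalizing σ ρ with
  | lam Θ M a b _ ih =>
    refine Red.lam (ih fun x c hx => ?_)
    cases x with
    | zero => exact .inl rfl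
    | succ x =>
      rcases hσ x c hx with h | ⟨hc, h⟩
      · exact .inl (by simp [up, h, Obj.rename, upRen])
      · exact .inr ⟨hc, by simp [up, h, Obj.rename, upRen, eta_rename]⟩
  | app Θ y as Ms hy h =>
    rw [subst_apps, rename_apps]
    have hMs : List.Forall₂ Red (Ms.map (Obj.subst σ)) (Ms.map (Obj.rename ρ)) := by
      rw [List.forall₂_map_left_iff, List.forall₂_map_right_iff, List.forall₂_same]
      intro M hM
      obtain ⟨j, hj, rfl⟩ := List.mem_iff_getElem.1 hM
      exact (h.get hj (h.length_eq ▸ hj)).2 (h.get hj (h.length_eq ▸ hj)).1 hσ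
    rcases hσ y _ hy with h' | ⟨hc, h'⟩
    · exact Red.apps (by rw [Obj.subst, h']; exact .refl) hMs
    · refine (Red.apps .refl hMs).trans ?_
      rw [Obj.subst, h']
      refine eta_apps (List.forall₂_map_left_iff.2 (forall₂_of_getElem h.length_eq ?_)) _
      intro j h₁ h₂
      rw [← eta_rename]
      refine (H Θ _ _ ?_ (h.get h₁ h₂).1).rename ρ
      exact (Arity.size_lt_of_mem (List.getElem_mem _)).trans_le hc

theorem Long.red_eta {Θ : List Arity} {N : Obj} {a : Arity} (h : Long Θ N a) :
    Red (eta a N) N := by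
  generalize hn : a.size = n
  induction n using Nat.strong_induction_on generalizing Θ N a with
  | _ n IH =>
  cases a with
  | base => exact .refl
  | arr a b =>
    obtain ⟨R, rfl, hR⟩ := h.arr_inv
    simp only [Arity.size] at hn
    refine Red.lam (Relation.ReflTransGen.trans (Red.eta (.head (.beta _ _) ?_) b) (IH b.size (by omega) hR rfl))
    rw [rename_upRen_inst]
    -- Contraction replaces the bound variable of `R` by its own expansion and fixes all others, so
    -- the corresponding renaming is the identity.
    have := hR.subst_eta_aux (n := a.size) (ρ := fun x => x)
      (σ := scons (Obj.eta a (.var 0)) fun x => .var (Nat.succ x))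
      (fun Θ N c hc hN => IH c.size (by omega) hN rfl) (by
        intro x c hx
        cases x with
        | zero =>
          simp only [List.getElem?_cons_zero, Option.some.injEq] at hx
          subst hx
          exact .inr ⟨le_rfl, rfl⟩
        | succ x => exact .inl rfl)
    rwa [rename_id] at this

/-- Substituting eta-expanded variables amounts to renaming. -/
theorem Long.subst_eta {Θ : List Arity} {M : Obj} {b : Arity} (h : Long Θ M b) {σ : ℕ → Obj}
    {ρ : ℕ → ℕ} (hσ : ∀ (x : ℕ) (c : Arity), Θ[x]? = some c →
      σ x = .var (ρ x) ∨ σ x = eta c (.var (ρ x))) :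
    Red (M.subst σ) (M.rename ρ) := by
  obtain ⟨n, hn⟩ : ∃ n, ∀ c ∈ Θ, c.size ≤ n := by
    clear h hσ
    induction Θ with
    | nil => exact ⟨0, by simp⟩
    | cons a Θ ih =>
      obtain ⟨n, hn⟩ := ih
      refine ⟨n + a.size, fun c hc => ?_⟩
      rcases List.mem_cons.1 hc with rfl | hc
      · omega
      · have := hn c hc; omega
  refine h.subst_eta_aux (n := n) (fun _ _ _ _ h => h.red_eta) fun x c hx => ?_
  exact (hσ x c hx).imp_right fun h => ⟨hn c (List.mem_of_getElem? hx), h⟩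

/-- This closed form has the shape of `EtaVar.mk`; among `m` binders, the one at position `j` has
index `m - 1 - j`. -/
theorem eta_arrs (as : List Arity) (h : Obj) :
    eta (.arrs as) h = lams as.length ((h.rename (· + as.length)).apps
      (as.mapIdx fun j a => eta a (.var (as.length - 1 - j)))) := by
  induction as generalizing h with
  | nil => simp [eta, lams, apps, rename_id]
  | cons a as ih =>
    have : eta (.arrs (a :: as)) h =
      .lam (eta (.arrs as) (.app (h.rename Nat.succ) (eta a (.var 0)))) := rfl
    rw [this, ih, List.mapIdx_cons]
    simp only [lams, List.length_cons, apps, List.foldl_cons, Obj.rename, rename_rename,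
      eta_rename, Nat.zero_add, Nat.add_sub_cancel, Nat.sub_zero]
    have h₁ : (fun x : ℕ => x.succ + as.length) = fun x => x + (as.length + 1) := by
      funext x; omega
    have h₂ : (fun (j : ℕ) (a : Arity) => eta a (.var (as.length - 1 - j))) =
        fun j a => eta a (.var (as.length - (j + 1))) := by
      funext j a; congr 2; omega
    rw [h₁, h₂]

theorem Long.lams_inv {Θ : List Arity} {m y : ℕ} {Ms : List Obj} {a : Arity}
    (h : Long Θ (lams m ((var y).apps Ms)) a) :
    ∃ as : List Arity, as.length = m ∧ a = .arrs as ∧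
      Long (as.reverse ++ Θ) ((var y).apps Ms) .base := by
  induction m generalizing Θ a with
  | zero =>
    cases a with
    | base => exact ⟨[], rfl, rfl, h⟩
    | arr a b =>
      obtain ⟨N, hN, _⟩ := h.arr_inv
      exact absurd hN (apps_var_ne_lam _ _ _)
  | succ m ih =>
    cases a with
    | base =>
      obtain ⟨_, _, _, h, _⟩ := h.base_inv
      exact absurd h.symm (apps_var_ne_lam _ _ _)
    | arr a b =>
      obtain ⟨N, hN, h⟩ := h.arr_inv
      cases hN
      obtain ⟨as, rfl, rfl, h'⟩ := ih h
      exact ⟨a :: as, rfl, rfl, by simpa using h'⟩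

end Obj

/-- `EtaVar` leaves the number of binders open, and longness fixes it. Each argument has the arity
its head asks for and, being an expanded bound variable, by induction also the arity of its binder;
so the two lists of arities coincide. -/
theorem EtaVar.eq_eta {y : ℕ} {M : Obj} (h : EtaVar y M) {Θ : List Arity} {a : Arity}
    (hL : Obj.Long Θ M a) : Θ[y]? = some a ∧ M = Obj.eta a (.var y) := by
  induction h generalizing Θ a with
  | mk y Ms _ ih =>
    obtain ⟨as, hlen, rfl, hL'⟩ := hL.lams_inv
    obtain ⟨z, as', Ms', heq, hz, hMs⟩ := hL'.base_inv
    obtain ⟨rfl, rfl⟩ := Obj.apps_var_inj heq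
    have hlen' := hMs.length_eq
    have key : ∀ (j : ℕ) (h₁ : j < Ms.length) (h₂ : j < as'.length) (h₃ : j < as.length),
        as[j] = as'[j] ∧ Ms[j] = Obj.eta as'[j] (.var (Ms.length - 1 - j)) := by
      intro j h₁ h₂ h₃
      have := ih j h₁ (hMs.get h₁ h₂)
      refine ⟨?_, this.2⟩
      have h' := this.1
      rw [List.getElem?_append_left (by simp; omega), List.getElem?_reverse (by omega)] at h'
      have : as.length - 1 - (Ms.length - 1 - j) = j := by omega
      rw [this, List.getElem?_eq_getElem h₃] at h'
      simpa using h'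
    have has : as = as' := List.ext_getElem (by omega) fun j h₁ h₂ => (key j (by omega) h₂ h₁).1
    subst has
    refine ⟨?_, ?_⟩
    · rw [List.getElem?_append_right (by simp; omega)] at hz
      simpa [hlen] using hz
    · rw [Obj.eta_arrs, hlen, Obj.rename]
      congr 2
      refine List.ext_getElem (by simp [hlen]) fun j h₁ h₂ => ?_
      rw [List.getElem_mapIdx, (key j h₁ (by omega) (by omega)).2]

/-! ### Long families -/

namespace Fam

/-- All objects in the family are in long form for some arity. -/
def Long : List Arity → Fam → Prop
  | _, con _ => True
  | Θ, pi A B => A.Long Θ ∧ B.Long (A.arity :: Θ)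
  | _, lam _ _ => False
  | Θ, app A M => A.Long Θ ∧ ∃ a, Obj.Long Θ M a

theorem Long.noLam {Θ : List Arity} {A : Fam} (h : A.Long Θ) : A.NoLam := by
  induction A generalizing Θ with
  | con u => trivial
  | pi A B ih₁ ih₂ => exact ⟨ih₁ h.1, ih₂ h.2⟩
  | lam => cases h
  | app A M ih => exact ih h.1

theorem Long.normal {Θ : List Arity} {A : Fam} (h : A.Long Θ) (B : Fam) : ¬ Step A B := by
  intro hs
  induction hs generalizing Θ with
  | beta => exact h.1
  | piL _ _ ih => exact ih h.1
  | piR _ _ ih => exact ih h.2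
  | lamL | lamR => exact h
  | appL _ _ ih => exact ih h.1
  | appR _ hs => exact h.2.choose_spec.normal _ hs

theorem Long.nf {Θ : List Arity} {A B : Fam} (h : B.Long Θ) (hr : Red A B) : NF A B :=
  ⟨hr.steps, h.normal⟩

theorem Long.rename {Θ Θ' : List Arity} {A : Fam} (h : A.Long Θ) {ρ : ℕ → ℕ}
    (hρ : ∀ (x : ℕ) (c : Arity), Θ[x]? = some c → Θ'[ρ x]? = some c) :
    (A.rename ρ).Long Θ' := by
  induction A generalizing Θ Θ' ρ with
  | con u => trivial
  | pi A B ih₁ ih₂ =>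
    refine ⟨ih₁ h.1 hρ, ih₂ h.2 fun x c hx => ?_⟩
    cases x with
    | zero => rw [arity_rename]; exact hx
    | succ x => exact hρ x c hx
  | lam => cases h
  | app A M ih =>
    obtain ⟨h₁, a, h₂⟩ := h
    exact ⟨ih h₁ hρ, a, h₂.rename hρ⟩

theorem Long.rename_succ {Θ : List Arity} {A : Fam} (h : A.Long Θ) (b : Arity) :
    (A.rename Nat.succ).Long (b :: Θ) :=
  h.rename fun _ _ hx => hx

theorem Long.subst {Θ Θ' : List Arity} {A : Fam} (h : A.Long Θ) {σ : ℕ → Obj}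
    (hσ : Obj.LongSubst Θ Θ' σ) : ∃ A', Red (A.subst σ) A' ∧ A'.Long Θ' := by
  induction A generalizing Θ Θ' σ with
  | con u => exact ⟨.con u, .con u, trivial⟩
  | pi A B ih₁ ih₂ =>
    obtain ⟨A', hA, hA'⟩ := ih₁ h.1 hσ
    obtain ⟨B', hB, hB'⟩ := ih₂ h.2 (hσ.up _)
    refine ⟨.pi A' B', .pi hA hB, hA', ?_⟩
    rwa [hA.arity, arity_subst]
  | lam => cases h
  | app A M ih =>
    obtain ⟨h₁, a, h₂⟩ := h
    obtain ⟨A', hA, hA'⟩ := ih h₁ hσ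
    obtain ⟨M', hM, hM'⟩ := h₂.subst hσ
    exact ⟨.app A' M', .app hA hM, hA', a, hM'⟩

theorem Long.subst_eta {Θ : List Arity} {A : Fam} (h : A.Long Θ) {σ : ℕ → Obj}
    {ρ : ℕ → ℕ} (hσ : ∀ (x : ℕ) (c : Arity), Θ[x]? = some c →
      σ x = .var (ρ x) ∨ σ x = Obj.eta c (.var (ρ x))) :
    Red (A.subst σ) (A.rename ρ) := by
  induction A generalizing Θ σ ρ with
  | con u => exact .con u
  | pi A B ih₁ ih₂ =>
    refine .pi (ih₁ h.1 hσ) (ih₂ h.2 fun x c hx => ?_)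
    cases x with
    | zero => exact .inl rfl
    | succ x =>
      rcases hσ x c hx with h | h
      · exact .inl (by simp [up, h, Obj.rename, upRen])
      · exact .inr (by simp [up, h, Obj.rename, upRen, Obj.eta_rename])
  | lam => cases h
  | app A M ih =>
    obtain ⟨h₁, a, h₂⟩ := h
    exact .app (ih h₁ hσ) (h₂.subst_eta hσ)

end Fam

theorem Fam.long_con_apps {Θ : List Arity} (u : ℕ) {Ms : List Obj} {as : List Arity}
    (h : List.Forall₂ (Obj.Long Θ) Ms as) : ((Fam.con u).apps Ms).Long Θ := by
  have key : ∀ A : Fam, A.Long Θ → (A.apps Ms).Long Θ := by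
    induction h with
    | nil => exact fun A hA => hA
    | cons h _ ih => exact fun A hA => ih (A.app _) ⟨hA, _, h⟩
  exact key _ trivial

/-! ### Spines -/

/-- The substitution that maps the innermost variables to `Ms` and the others as `σ` does. -/
def insts (σ : ℕ → Obj) (Ms : List Obj) : ℕ → Obj :=
  fun n => Ms.reverse.getD n (σ (n - Ms.length))

theorem insts_nil (σ : ℕ → Obj) : insts σ [] = σ := by
  funext n; simp [insts]

/-- The first argument belongs to the outermost substituted variable, right next to the tail `σ`.
This links the simultaneous substitution of the rules to substitution of one argument at a time. -/
theorem insts_cons (σ : ℕ → Obj) (M : Obj) (Ms : List Obj) :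
    insts σ (M :: Ms) = insts (scons M σ) Ms := by
  funext n
  simp only [insts, List.reverse_cons, List.length_cons, List.getD_eq_getElem?_getD]
  rcases lt_trichotomy n Ms.length with h | h | h
  · rw [List.getElem?_append_left (by simpa using h), List.getElem?_eq_getElem (by simpa using h)]
    rfl
  · subst h
    rw [List.getElem?_append_right (by simp), List.getElem?_eq_none (l := Ms.reverse) (by simp)]
    simp [scons]
  · rw [List.getElem?_append_right (by simpa using h.le), List.getElem?_eq_none (by simp; omega),
      List.getElem?_eq_none (by simpa using h.le)]
    obtain ⟨k, rfl⟩ := Nat.exists_eq_add_of_lt h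
    have h₁ : Ms.length + k + 1 - (Ms.length + 1) = k := by omega
    have h₂ : Ms.length + k + 1 - Ms.length = k + 1 := by omega
    rw [h₁, h₂]; rfl

def Fam.Normal (A : Fam) : Prop := ∀ B, ¬ Fam.Step A B

/-- `Spine R C Ms Q`: a head of type `C` can be applied to the arguments `Ms`, which are related by
`R` to their types, and the application has the base type `Q`. -/
def Spine (R : Obj → Fam → Prop) : Fam → List Obj → Fam → Prop
  | C, [], Q => C.Atomic ∧ Fam.Red C Q
  | C, M :: Ms, Q => ∃ A B A', C = .pi A B ∧ Fam.Red A A' ∧ R M A' ∧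
      Spine R (B.subst (inst [M])) Ms Q

namespace Spine

variable {R R' : Obj → Fam → Prop}

theorem imp {C Q : Fam} {Ms : List Obj} (h : Spine R C Ms Q)
    (hR : ∀ M A, M ∈ Ms → R M A → R' M A) : Spine R' C Ms Q := by
  induction Ms generalizing C with
  | nil => exact h
  | cons M Ms ih =>
    obtain ⟨A, B, A', rfl, hA, hM, h⟩ := h
    exact ⟨A, B, A', rfl, hA, hR _ _ (by simp) hM, ih h fun M A h => hR M A (by simp [h])⟩

/-- The rules substitute earlier arguments simultaneously and `Spine` substitutes them one by one;
the arbitrary `σ` accumulates those already passed. -/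
theorem of_pis {Bs : List Fam} {P Q : Fam} (hP : P.Atomic) (hn : (Fam.pis Bs P).NoLam)
    {σ : ℕ → Obj} {Ms : List Obj} {Cs : ℕ → Fam} (hlen : Ms.length = Bs.length)
    (hC : ∀ (j : ℕ) (_ : j < Ms.length) (h : j < Bs.length),
      Fam.NF (Bs[j].subst (insts σ (Ms.take j))) (Cs j))
    (hR : ∀ (j : ℕ) (h : j < Ms.length), R Ms[j] (Cs j))
    (hQ : Fam.Red (P.subst (insts σ Ms)) Q) : Spine R ((Fam.pis Bs P).subst σ) Ms Q := by
  induction Bs generalizing σ Ms Cs with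
  | nil =>
    obtain rfl := List.length_eq_zero_iff.1 hlen
    rw [insts_nil] at hQ
    exact ⟨Fam.atomic_subst.2 hP, hQ⟩
  | cons B Bs ih =>
    cases Ms with
    | nil => simp at hlen
    | cons M Ms =>
      have h₀ := hC 0 (by simp) (by simp)
      simp only [List.take_zero, insts_nil, List.getElem_cons_zero] at h₀
      refine ⟨B.subst σ, (Fam.pis Bs P).subst (up σ), Cs 0, rfl,
        (Fam.noLam_subst.2 hn.1).red_of_steps h₀.1, hR 0 (by simp), ?_⟩
      rw [Fam.subst_up_inst]
      refine ih hn.2 (Cs := fun j => Cs (j + 1)) (by simpa using hlen) ?_ ?_ ?_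
      · intro j h₁ h₂
        have := hC (j + 1) (by simpa using h₁) (by simpa using h₂)
        simpa [insts_cons] using this
      · intro j h₁
        exact hR (j + 1) (by simpa using h₁)
      · rwa [insts_cons] at hQ

theorem exists_pis {C Q : Fam} {σ : ℕ → Obj} {Ms : List Obj} (h : Spine R (C.subst σ) Ms Q) :
    ∃ Bs P, ∃ Cs : ℕ → Fam, C = Fam.pis Bs P ∧ P.Atomic ∧ Ms.length = Bs.length ∧
      (∀ (j : ℕ) (_ : j < Ms.length) (h : j < Bs.length),
        Fam.Red (Bs[j].subst (insts σ (Ms.take j))) (Cs j)) ∧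
      (∀ (j : ℕ) (h : j < Ms.length), R Ms[j] (Cs j)) ∧
      Fam.Red (P.subst (insts σ Ms)) Q := by
  induction Ms generalizing C σ with
  | nil =>
    refine ⟨[], C, fun _ => C, rfl, Fam.atomic_subst.1 h.1, rfl, ?_, ?_, ?_⟩
    · intro j h₁; simp at h₁
    · intro j h₁; simp at h₁
    · rw [insts_nil]; exact h.2
  | cons M Ms ih =>
    obtain ⟨A, B, A', hC, hA, hM, h⟩ := h
    cases C with
    | pi C D =>
      simp only [Fam.subst, Fam.pi.injEq] at hC
      obtain ⟨rfl, rfl⟩ := hC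
      rw [Fam.subst_up_inst] at h
      obtain ⟨Bs, P, Cs, rfl, hP, hlen, h₁, h₂, h₃⟩ := ih h
      refine ⟨C :: Bs, P, fun j => Nat.casesOn j A' Cs, rfl, hP, by simp [hlen], ?_, ?_, ?_⟩
      · intro j hj hj'
        cases j with
        | zero => simpa [insts_nil] using hA
        | succ j => simpa [insts_cons] using h₁ j (by simpa using hj) (by simpa using hj')
      · intro j hj
        cases j with
        | zero => exact hM
        | succ j => exact h₂ j (by simpa using hj)
      · rwa [insts_cons]
    | _ => simp [Fam.subst] at hC

theorem exists_pis_inst {C Q : Fam} {Ms : List Obj} (h : Spine R C Ms Q) :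
    ∃ Bs P, ∃ Cs : ℕ → Fam, C = Fam.pis Bs P ∧ P.Atomic ∧ Ms.length = Bs.length ∧
      (∀ (j : ℕ) (_ : j < Ms.length) (h : j < Bs.length),
        Fam.Red (Bs[j].subst (inst (Ms.take j))) (Cs j)) ∧
      (∀ (j : ℕ) (h : j < Ms.length), R Ms[j] (Cs j)) ∧
      Fam.Red (P.subst (inst Ms)) Q := by
  rw [← C.subst_var] at h
  exact h.exists_pis

/-- Reduction of the type of the head. -/
theorem red {C C' Q : Fam} {Ms : List Obj} (h : Spine R C Ms Q) (hC : Fam.Red C C')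
    (hR : ∀ M A, R M A → A.Normal) (hQ : Q.Normal) : Spine R C' Ms Q := by
  induction Ms generalizing C C' with
  | nil => exact ⟨hC.atomic.2 h.1, hC.to_normal h.2 hQ⟩
  | cons M Ms ih =>
    obtain ⟨A, B, A', rfl, hA, hM, h⟩ := h
    cases hC with
    | pi hA₁ hB₁ =>
      -- The argument keeps its type `A'`: being normal, it is still reached from the reduced
      -- domain, by confluence.
      exact ⟨_, _, A', rfl, hA₁.to_normal hA (hR _ _ hM), hM, ih h (hB₁.subst fun _ => .refl)⟩

theorem atomic {C Q : Fam} {Ms : List Obj} (h : Spine R C Ms Q) : Q.Atomic := by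
  induction Ms generalizing C with
  | nil => exact h.2.atomic.2 h.1
  | cons M Ms ih => obtain ⟨_, _, _, _, _, _, h⟩ := h; exact ih h

/-- Substitution and reduction preserve arities, so those of the arguments can be read off `C`.
After each argument, hereditary substitution makes the remaining codomain long again and `Spine.red`
moves the spine there. -/
theorem long {Θ : List Arity} {C Q : Fam} {Ms : List Obj} (h : Spine R C Ms Q) (hC : C.Long Θ)
    (hR : ∀ M A, R M A → A.Normal ∧ Obj.Long Θ M A.arity) (hQ : Q.Normal) :
    ∃ as, C.arity = .arrs as ∧ List.Forall₂ (Obj.Long Θ) Ms as ∧ Q.Long Θ := by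
  induction Ms generalizing C with
  | nil => exact ⟨[], h.1.arity, .nil, by rwa [h.2.eq_of_normal hC.normal]⟩
  | cons M Ms ih =>
    obtain ⟨A, B, A', rfl, hA, hM, h⟩ := h
    have hL : Obj.Long Θ M A.arity := by rw [← hA.arity]; exact (hR _ _ hM).2
    obtain ⟨B', hB, hB'⟩ := hC.2.subst (Obj.LongSubst.inst hL)
    obtain ⟨as, has, hMs, hQ'⟩ := ih (h.red hB (fun M A h => (hR M A h).1) hQ) hB'
    refine ⟨A.arity :: as, ?_, .cons hL hMs, hQ'⟩
    rw [hB.arity, Fam.arity_subst] at has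
    simp only [Fam.arity, has]; rfl

end Spine

/-! ### Contexts -/

namespace Ctx

theorem HasObj.unique {Γ : Ctx} {x : ℕ} {A B : Fam} (h : HasObj Γ x A) (h' : HasObj Γ x B) :
    A = B := by
  induction h generalizing B with
  | here => cases h'; rfl
  | there_obj _ _ ih =>
    cases h' with
    | there_obj _ h' => rw [ih h']
  | there_fam _ _ _ ih =>
    cases h' with
    | there_fam _ _ h' => rw [ih h']

theorem HasObj.arities {Γ : Ctx} {x : ℕ} {A : Fam} (h : HasObj Γ x A) :
    (Ctx.arities Γ)[x]? = some A.arity := by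
  induction h <;> simp_all [Ctx.arities, Fam.arity_rename]

theorem exists_hasObj {Γ : Ctx} {x : ℕ} {c : Arity} (h : (arities Γ)[x]? = some c) :
    ∃ A, HasObj Γ x A ∧ A.arity = c := by
  induction Γ generalizing x with
  | nil => simp [arities] at h
  | cons D Γ ih =>
    cases D with
    | obj A =>
      cases x with
      | zero => exact ⟨_, .here Γ A, by simpa [arities, Fam.arity_rename] using h⟩
      | succ x =>
        obtain ⟨B, hB, rfl⟩ := ih (x := x) (by simpa [arities] using h)
        exact ⟨_, .there_obj A hB, Fam.arity_rename _ _⟩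
    | fam u K =>
      obtain ⟨B, hB, rfl⟩ := ih h
      exact ⟨_, .there_fam u K hB, rfl⟩

end Ctx

/-! ### Derivations -/

/-- A family of predicates on the four forms of assertion; for families only `Γ ⊢ A : type` is of
interest. -/
def Judgment.Holds (mc : Ctx → Prop) (mk : Ctx → Kind → Prop) (mf : Ctx → Fam → Prop)
    (mo : Ctx → Obj → Fam → Prop) : Judgment → Prop
  | .ctx Γ => mc Γ
  | .kind Γ K => mk Γ K
  | .fam Γ A K => K = .type → mf Γ A
  | .obj Γ M A => mo Γ M A

namespace Derivable

/-- A family abstraction has a product kind, never `type`. This precedes `ind`, which needs it to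
read the reductions in the rules componentwise. -/
theorem noLam {J : Judgment} (h : Derivable J) :
    J.Holds (fun Γ => (∀ x A, Ctx.HasObj Γ x A → A.NoLam) ∧
      ∀ u K, Ctx.HasFam Γ u K → ∀ v, (K.toFam v).NoLam)
      (fun _ K => ∀ v, (K.toFam v).NoLam) (fun _ A => A.NoLam) (fun _ _ _ => True) := by
  induction h with
  | nullCtx => exact ⟨by rintro _ _ ⟨⟩, by rintro _ _ ⟨⟩⟩
  | kindCtx u _ _ _ ih₁ ih₂ =>
    refine ⟨?_, ?_⟩
    · rintro x A (_ | _ | ⟨_, _, h⟩); exact ih₂.1 _ _ h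
    · rintro x A (_ | _ | ⟨_, _, h⟩)
      · exact ih₁
      · exact ih₂.2 _ _ h
  | typeCtx _ _ ih₁ ih₂ =>
    refine ⟨?_, ?_⟩
    · rintro x A (_ | ⟨_, h⟩)
      · exact Fam.noLam_rename.2 (ih₁ rfl)
      · exact Fam.noLam_rename.2 (ih₂.1 _ _ h)
    · rintro x A (_ | ⟨_, h⟩) v
      rw [Kind.toFam_rename]
      exact Fam.noLam_rename.2 (ih₂.2 _ _ h v)
  | typeKind => intro v; trivial
  | piKind _ _ ih₁ ih₂ => exact fun v => ⟨ih₁ rfl, ih₂ v⟩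
  | piFam _ _ ih₁ ih₂ => exact fun _ => ⟨ih₁ rfl, ih₂ rfl⟩
  | absFam => rintro ⟨⟩
  | appFam => exact fun _ => Fam.noLam_con_apps _ _
  | absObj => trivial
  | appObj => trivial

/-- Both backchaining rules appear here in the form of spines, so that later inductions recurse on
argument lists and treat constants like variables via `Kind.toFam`. -/
theorem ind {mc : Ctx → Prop} {mk : Ctx → Kind → Prop} {mf : Ctx → Fam → Prop}
    {mo : Ctx → Obj → Fam → Prop}
    (ctx_nil : mc [])
    (ctx_fam : ∀ (Γ : Ctx) (u : ℕ) (K : Kind), Derivable (.kind Γ K) → Derivable (.ctx Γ) →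
      (∀ L, ¬ Ctx.HasFam Γ u L) → mk Γ K → mc Γ → mc (.fam u K :: Γ))
    (ctx_obj : ∀ (Γ : Ctx) (A : Fam), Derivable (.fam Γ A .type) → Derivable (.ctx Γ) →
      mf Γ A → mc Γ → mc (.obj A :: Γ))
    (kind_type : ∀ Γ : Ctx, Derivable (.ctx Γ) → mc Γ → mk Γ .type)
    (kind_pi : ∀ (Γ : Ctx) (A : Fam) (K : Kind), Derivable (.fam Γ A .type) →
      Derivable (.kind (.obj A :: Γ) K) → mf Γ A → mk (.obj A :: Γ) K → mk Γ (.pi A K))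
    (fam_pi : ∀ (Γ : Ctx) (A B : Fam), Derivable (.fam Γ A .type) →
      Derivable (.fam (.obj A :: Γ) B .type) → mf Γ A → mf (.obj A :: Γ) B → mf Γ (.pi A B))
    (fam_app : ∀ (Γ : Ctx) (u : ℕ) (K : Kind) (Ms : List Obj), Derivable (.ctx Γ) → mc Γ →
      Ctx.HasFam Γ u K →
      Spine (fun M A => Derivable (.obj Γ M A) ∧ A.Normal ∧ mo Γ M A) (K.toFam u) Ms (.con u) →
      mf Γ ((Fam.con u).apps Ms))
    (obj_lam : ∀ (Γ : Ctx) (A B : Fam) (M : Obj), Derivable (.fam Γ A .type) →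
      Derivable (.obj (.obj A :: Γ) M B) → mf Γ A → mo (.obj A :: Γ) M B →
      mo Γ (.lam M) (.pi A B))
    (obj_app : ∀ (Γ : Ctx) (y : ℕ) (C Q : Fam) (Ms : List Obj), Derivable (.ctx Γ) → mc Γ →
      Ctx.HasObj Γ y C →
      Spine (fun M A => Derivable (.obj Γ M A) ∧ A.Normal ∧ mo Γ M A) C Ms Q → Q.Normal →
      mo Γ ((Obj.var y).apps Ms) Q)
    {J : Judgment} (h : Derivable J) : J.Holds mc mk mf mo := by
  induction h with
  | nullCtx => exact ctx_nil
  | kindCtx u h₁ h₂ h₃ ih₁ ih₂ => exact ctx_fam _ _ _ h₁ h₂ h₃ ih₁ ih₂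
  | typeCtx h₁ h₂ ih₁ ih₂ => exact ctx_obj _ _ h₁ h₂ (ih₁ rfl) ih₂
  | typeKind h ih => exact kind_type _ h ih
  | piKind h₁ h₂ ih₁ ih₂ => exact kind_pi _ _ _ h₁ h₂ (ih₁ rfl) ih₂
  | piFam h₁ h₂ ih₁ ih₂ => exact fun _ => fam_pi _ _ _ h₁ h₂ (ih₁ rfl) (ih₂ rfl)
  | absFam => rintro ⟨⟩
  | @appFam Γ u Bs Ms Cs hΓ hu hlen hC hM ihΓ ihM =>
    intro _
    refine fam_app _ _ _ _ hΓ ihΓ hu ?_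
    have hn := hΓ.noLam.2 _ _ hu u
    rw [Kind.toFam_pis] at hn ⊢
    rw [← (Fam.pis Bs (.con u)).subst_var]
    exact Spine.of_pis (P := .con u) trivial hn hlen hC
      (fun j h => ⟨hM j h, (hC j h (hlen ▸ h)).2, ihM j h⟩) (.con u)
  | absObj h₁ h₂ ih₁ ih₂ => exact obj_lam _ _ _ _ h₁ h₂ (ih₁ rfl) ih₂
  | @appObj Γ y Bs P Q Ms Cs hΓ hy hP hlen hC hM hQ ihΓ ihM =>
    refine obj_app _ _ _ _ _ hΓ ihΓ hy ?_ hQ.2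
    have hn := hΓ.noLam.1 _ _ hy
    rw [← (Fam.pis Bs P).subst_var]
    exact Spine.of_pis (Fam.atomic_iff_isBase.2 hP) hn hlen hC
      (fun j h => ⟨hM j h, (hC j h (hlen ▸ h)).2, ihM j h⟩)
      ((Fam.noLam_subst.2 (Fam.noLam_pis.1 hn).2).red_of_steps hQ.1)

/-- Induction on derivations of `Γ ⊢ A : type` and `Γ ⊢ M : A`. -/
theorem ind' {mf : Ctx → Fam → Prop} {mo : Ctx → Obj → Fam → Prop}
    (fam_pi : ∀ (Γ : Ctx) (A B : Fam), Derivable (.fam Γ A .type) →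
      Derivable (.fam (.obj A :: Γ) B .type) → mf Γ A → mf (.obj A :: Γ) B → mf Γ (.pi A B))
    (fam_app : ∀ (Γ : Ctx) (u : ℕ) (K : Kind) (Ms : List Obj), Derivable (.ctx Γ) →
      Ctx.HasFam Γ u K →
      Spine (fun M A => Derivable (.obj Γ M A) ∧ A.Normal ∧ mo Γ M A) (K.toFam u) Ms (.con u) →
      mf Γ ((Fam.con u).apps Ms))
    (obj_lam : ∀ (Γ : Ctx) (A B : Fam) (M : Obj), Derivable (.fam Γ A .type) →
      Derivable (.obj (.obj A :: Γ) M B) → mf Γ A → mo (.obj A :: Γ) M B →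
      mo Γ (.lam M) (.pi A B))
    (obj_app : ∀ (Γ : Ctx) (y : ℕ) (C Q : Fam) (Ms : List Obj), Derivable (.ctx Γ) →
      Ctx.HasObj Γ y C →
      Spine (fun M A => Derivable (.obj Γ M A) ∧ A.Normal ∧ mo Γ M A) C Ms Q → Q.Normal →
      mo Γ ((Obj.var y).apps Ms) Q)
    {J : Judgment} (h : Derivable J) :
    J.Holds (fun _ => True) (fun _ _ => True) mf mo :=
  h.ind trivial (fun _ _ _ _ _ _ _ _ => trivial) (fun _ _ _ _ _ _ => trivial)
    (fun _ _ _ => trivial) (fun _ _ _ _ _ _ _ => trivial) fam_pi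
    (fun Γ u K Ms h _ => fam_app Γ u K Ms h) obj_lam
    (fun Γ y C Q Ms h _ => obj_app Γ y C Q Ms h)

/-! ### Valid contexts, long forms and inversion -/

theorem ctx_valid {J : Judgment} (h : Derivable J) :
    J.Holds (fun _ => True) (fun _ _ => True) (fun Γ _ => Derivable (.ctx Γ))
      (fun Γ _ _ => Derivable (.ctx Γ)) :=
  h.ind' (fun _ _ _ _ _ h _ => h) (fun _ _ _ _ h _ _ => h) (fun _ _ _ _ _ _ h _ => h)
    (fun _ _ _ _ _ h _ _ _ => h)

theorem fam_ctx {Γ : Ctx} {A : Fam} (h : Derivable (.fam Γ A .type)) : Derivable (.ctx Γ) :=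
  h.ctx_valid rfl

theorem obj_ctx {Γ : Ctx} {M : Obj} {A : Fam} (h : Derivable (.obj Γ M A)) :
    Derivable (.ctx Γ) :=
  h.ctx_valid

/-- Declared types are long, and instantiating them with long arguments normalizes to long types by
hereditary substitution; contexts, kinds, types and objects therefore go through one induction. -/
theorem long {J : Judgment} (h : Derivable J) :
    J.Holds (fun Γ => (∀ x A, Ctx.HasObj Γ x A → A.Long (Ctx.arities Γ)) ∧
      ∀ u K, Ctx.HasFam Γ u K → ∀ v, (K.toFam v).Long (Ctx.arities Γ))
      (fun Γ K => ∀ v, (K.toFam v).Long (Ctx.arities Γ))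
      (fun Γ A => A.Long (Ctx.arities Γ))
      (fun Γ M A => Obj.Long (Ctx.arities Γ) M A.arity ∧ A.Long (Ctx.arities Γ)) := by
  refine h.ind ?_ ?_ ?_ ?_ ?_ ?_ ?_ ?_ ?_
  · exact ⟨by rintro _ _ ⟨⟩, by rintro _ _ ⟨⟩⟩
  · intro Γ u K _ _ _ ih₁ ih₂
    refine ⟨?_, ?_⟩
    · rintro x A (_ | _ | ⟨_, _, h⟩); exact ih₂.1 _ _ h
    · rintro x A (_ | _ | ⟨_, _, h⟩)
      · exact ih₁
      · exact ih₂.2 _ _ h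
  · intro Γ A _ _ ih₁ ih₂
    refine ⟨?_, ?_⟩
    · rintro x A (_ | ⟨_, h⟩)
      · exact ih₁.rename_succ _
      · exact (ih₂.1 _ _ h).rename_succ _
    · rintro x A (_ | ⟨_, h⟩) v
      rw [Kind.toFam_rename]
      exact (ih₂.2 _ _ h v).rename_succ _
  · intro Γ _ _ v; trivial
  · exact fun Γ A K _ _ ih₁ ih₂ v => ⟨ih₁, ih₂ v⟩
  · exact fun Γ A B _ _ ih₁ ih₂ => ⟨ih₁, ih₂⟩
  · intro Γ u K Ms _ ihΓ hu hs
    obtain ⟨as, _, hMs, _⟩ := hs.long (ihΓ.2 _ _ hu u) (fun M A h => ⟨h.2.1, h.2.2.1⟩)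
      (by rintro B ⟨⟩)
    exact Fam.long_con_apps u hMs
  · exact fun Γ A B M _ _ ih₁ ih₂ => ⟨.lam ih₂.1, ih₁, ih₂.2⟩
  · intro Γ y C Q Ms _ ihΓ hy hs hQ
    obtain ⟨as, has, hMs, hQ'⟩ := hs.long (ihΓ.1 _ _ hy) (fun M A h => ⟨h.2.1, h.2.2.1⟩) hQ
    rw [hs.atomic.arity]
    exact ⟨.app_forall₂ (has ▸ hy.arities) hMs, hQ'⟩

theorem fam_long {Γ : Ctx} {A : Fam} (h : Derivable (.fam Γ A .type)) :
    A.Long (Ctx.arities Γ) :=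
  h.long rfl

theorem obj_long {Γ : Ctx} {M : Obj} {A : Fam} (h : Derivable (.obj Γ M A)) :
    Obj.Long (Ctx.arities Γ) M A.arity ∧ A.Long (Ctx.arities Γ) :=
  h.long

theorem obj_normal {Γ : Ctx} {M : Obj} {A : Fam} (h : Derivable (.obj Γ M A)) : A.Normal :=
  h.obj_long.2.normal

theorem hasObj_long {Γ : Ctx} (h : Derivable (.ctx Γ)) {x : ℕ} {A : Fam}
    (hx : Ctx.HasObj Γ x A) : A.Long (Ctx.arities Γ) :=
  h.long.1 x A hx

theorem hasFam_long {Γ : Ctx} (h : Derivable (.ctx Γ)) {u : ℕ} {K : Kind}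
    (hu : Ctx.HasFam Γ u K) (v : ℕ) : (K.toFam v).Long (Ctx.arities Γ) :=
  h.long.2 u K hu v

/-- The types of derivable objects are normal, so the spine need not supply the normality premises
of the rule. -/
theorem fam_app {Γ : Ctx} {u : ℕ} {K : Kind} {Ms : List Obj} (hΓ : Derivable (.ctx Γ))
    (hu : Ctx.HasFam Γ u K)
    (h : Spine (fun M A => Derivable (.obj Γ M A)) (K.toFam u) Ms (.con u)) :
    Derivable (.fam Γ ((Fam.con u).apps Ms) .type) := by
  obtain ⟨Bs, P, Cs, hK, hP, hlen, h₁, h₂, _⟩ := h.exists_pis_inst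
  obtain ⟨rfl, rfl⟩ := Kind.eq_pis_of_toFam hP hK
  exact .appFam Cs hΓ hu hlen
    (fun j hj hj' => ⟨(h₁ j hj hj').steps, (h₂ j hj).obj_normal⟩) h₂

theorem obj_app {Γ : Ctx} {y : ℕ} {C Q : Fam} {Ms : List Obj} (hΓ : Derivable (.ctx Γ))
    (hy : Ctx.HasObj Γ y C) (h : Spine (fun M A => Derivable (.obj Γ M A)) C Ms Q)
    (hQ : Q.Normal) : Derivable (.obj Γ ((Obj.var y).apps Ms) Q) := by
  obtain ⟨Bs, P, Cs, rfl, hP, hlen, h₁, h₂, h₃⟩ := h.exists_pis_inst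
  exact .appObj Cs hΓ hy (Fam.atomic_iff_isBase.1 hP) hlen
    (fun j hj hj' => ⟨(h₁ j hj hj').steps, (h₂ j hj).obj_normal⟩) h₂ ⟨h₃.steps, hQ⟩

/-- An iterated application is not a constructor pattern, so inversion is stated through equations
on the subject and settled by injectivity of `apps`. -/
theorem inversion {J : Judgment} (h : Derivable J) :
    J.Holds (fun _ => True) (fun _ _ => True)
      (fun Γ A => (∀ A₁ A₂, A = .pi A₁ A₂ →
          Derivable (.fam Γ A₁ .type) ∧ Derivable (.fam (.obj A₁ :: Γ) A₂ .type)) ∧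
        ∀ u Ms, A = (Fam.con u).apps Ms → ∃ K, Ctx.HasFam Γ u K ∧
          Spine (fun M A => Derivable (.obj Γ M A)) (K.toFam u) Ms (.con u))
      (fun Γ M A => (∀ N, M = .lam N → ∃ A₁ A₂, A = .pi A₁ A₂ ∧
          Derivable (.fam Γ A₁ .type) ∧ Derivable (.obj (.obj A₁ :: Γ) N A₂)) ∧
        ∀ y Ms, M = (Obj.var y).apps Ms → ∃ C, Ctx.HasObj Γ y C ∧
          Spine (fun M A => Derivable (.obj Γ M A)) C Ms A) := by
  refine h.ind' ?_ ?_ ?_ ?_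
  · intro Γ A B h₁ h₂ _ _
    refine ⟨?_, fun u Ms h => absurd h.symm (Fam.apps_con_ne_pi _ _ _ _)⟩
    rintro _ _ ⟨⟩; exact ⟨h₁, h₂⟩
  · intro Γ u K Ms _ hu hs
    refine ⟨fun _ _ h => absurd h (Fam.apps_con_ne_pi _ _ _ _), fun v Ms' h => ?_⟩
    obtain ⟨rfl, rfl⟩ := Fam.apps_con_inj h
    exact ⟨K, hu, hs.imp fun _ _ _ h => h.1⟩
  · intro Γ A B M h₁ h₂ _ _
    refine ⟨?_, fun u Ms h => absurd h.symm (Obj.apps_var_ne_lam _ _ _)⟩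
    rintro _ ⟨⟩; exact ⟨_, _, rfl, h₁, h₂⟩
  · intro Γ y C Q Ms _ hy hs _
    refine ⟨fun _ h => absurd h (Obj.apps_var_ne_lam _ _ _), fun v Ms' h => ?_⟩
    obtain ⟨rfl, rfl⟩ := Obj.apps_var_inj h
    exact ⟨C, hy, hs.imp fun _ _ _ h => h.1⟩

theorem pi_inv {Γ : Ctx} {A B : Fam} (h : Derivable (.fam Γ (.pi A B) .type)) :
    Derivable (.fam Γ A .type) ∧ Derivable (.fam (.obj A :: Γ) B .type) :=
  (h.inversion rfl).1 _ _ rfl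

theorem fam_app_inv {Γ : Ctx} {u : ℕ} {Ms : List Obj}
    (h : Derivable (.fam Γ ((Fam.con u).apps Ms) .type)) :
    ∃ K, Ctx.HasFam Γ u K ∧
      Spine (fun M A => Derivable (.obj Γ M A)) (K.toFam u) Ms (.con u) :=
  (h.inversion rfl).2 _ _ rfl

theorem lam_inv {Γ : Ctx} {M : Obj} {A : Fam} (h : Derivable (.obj Γ (.lam M) A)) :
    ∃ A₁ A₂, A = .pi A₁ A₂ ∧ Derivable (.fam Γ A₁ .type) ∧
      Derivable (.obj (.obj A₁ :: Γ) M A₂) :=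
  h.inversion.1 _ rfl

theorem app_inv {Γ : Ctx} {y : ℕ} {Ms : List Obj} {Q : Fam}
    (h : Derivable (.obj Γ ((Obj.var y).apps Ms) Q)) :
    ∃ C, Ctx.HasObj Γ y C ∧ Spine (fun M A => Derivable (.obj Γ M A)) C Ms Q :=
  h.inversion.2 _ _ rfl

theorem ctx_obj_inv {Γ : Ctx} {A : Fam} (h : Derivable (.ctx (.obj A :: Γ))) :
    Derivable (.fam Γ A .type) ∧ Derivable (.ctx Γ) := by
  cases h with
  | typeCtx h₁ h₂ => exact ⟨h₁, h₂⟩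

theorem ctx_fam_inv {Γ : Ctx} {u : ℕ} {K : Kind} (h : Derivable (.ctx (.fam u K :: Γ))) :
    Derivable (.kind Γ K) ∧ Derivable (.ctx Γ) ∧ ∀ L, ¬ Ctx.HasFam Γ u L := by
  cases h with
  | kindCtx _ h₁ h₂ h₃ => exact ⟨h₁, h₂, h₃⟩

theorem hasFam_unique {Γ : Ctx} (h : Derivable (.ctx Γ)) {u : ℕ} {K L : Kind}
    (hK : Ctx.HasFam Γ u K) (hL : Ctx.HasFam Γ u L) : K = L := by
  induction hK generalizing L with
  | here Γ u K =>
    cases hL with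
    | here => rfl
    | there_fam _ _ hL => exact absurd hL (h.ctx_fam_inv.2.2 _)
  | there_obj _ _ ih =>
    cases hL with
    | there_obj _ hL => rw [ih h.ctx_obj_inv.2 hL]
  | there_fam _ _ hK ih =>
    cases hL with
    | here => exact absurd hK (h.ctx_fam_inv.2.2 _)
    | there_fam _ _ hL => exact ih h.ctx_fam_inv.2.1 hL

end Derivable

/-! ### Weakening -/

theorem Fam.rename_succ_rename (A : Fam) (ρ : ℕ → ℕ) :
    (A.rename ρ).rename Nat.succ = (A.rename Nat.succ).rename (upRen ρ) := by
  rw [Fam.rename_rename, Fam.rename_rename]; rfl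

theorem Kind.rename_succ_rename (K : Kind) (ρ : ℕ → ℕ) :
    (K.rename ρ).rename Nat.succ = (K.rename Nat.succ).rename (upRen ρ) := by
  apply Kind.toFam_injective 0
  simp only [Kind.toFam_rename, Fam.rename_succ_rename]

theorem Kind.rename_id (K : Kind) : K.rename (fun x => x) = K := by
  apply Kind.toFam_injective 0
  rw [Kind.toFam_rename, Fam.rename_id]

theorem Kind.rename_rename (K : Kind) (ρ ρ' : ℕ → ℕ) :
    (K.rename ρ).rename ρ' = K.rename (fun x => ρ' (ρ x)) := by
  apply Kind.toFam_injective 0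
  simp only [Kind.toFam_rename, Fam.rename_rename]

/-- `ρ` maps the declarations of `Γ` to declarations of `Γ'`. -/
structure Ctx.Renames (Γ Γ' : Ctx) (ρ : ℕ → ℕ) : Prop where
  obj : ∀ x A, Ctx.HasObj Γ x A → Ctx.HasObj Γ' (ρ x) (A.rename ρ)
  fam : ∀ u K, Ctx.HasFam Γ u K → Ctx.HasFam Γ' u (K.rename ρ)

theorem Ctx.Renames.up {Γ Γ' : Ctx} {ρ : ℕ → ℕ} (h : Ctx.Renames Γ Γ' ρ) (A : Fam) :
    Ctx.Renames (.obj A :: Γ) (.obj (A.rename ρ) :: Γ') (upRen ρ) where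
  obj := by
    rintro _ _ (_ | ⟨_, hx⟩)
    · rw [← Fam.rename_succ_rename]; exact .here _ _
    · rw [← Fam.rename_succ_rename]; exact .there_obj _ (h.obj _ _ hx)
  fam := by
    rintro _ _ (_ | ⟨_, hx⟩)
    rw [← Kind.rename_succ_rename]; exact .there_obj _ (h.fam _ _ hx)

theorem Ctx.Renames.arities {Γ Γ' : Ctx} {ρ : ℕ → ℕ} (h : Ctx.Renames Γ Γ' ρ) {x : ℕ} {c : Arity}
    (hx : (Ctx.arities Γ)[x]? = some c) : (Ctx.arities Γ')[ρ x]? = some c := by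
  obtain ⟨A, hA, rfl⟩ := Ctx.exists_hasObj hx
  rw [(h.obj _ _ hA).arities, Fam.arity_rename]

theorem Spine.rename {R R' : Obj → Fam → Prop} {C Q : Fam} {Ms : List Obj} {ρ : ℕ → ℕ}
    (h : Spine R C Ms Q) (hR : ∀ M A, R M A → R' (M.rename ρ) (A.rename ρ)) :
    Spine R' (C.rename ρ) (Ms.map (Obj.rename ρ)) (Q.rename ρ) := by
  induction Ms generalizing C with
  | nil => exact ⟨Fam.atomic_rename.2 h.1, h.2.rename ρ⟩
  | cons M Ms ih =>
    obtain ⟨A, B, A', rfl, hA, hM, h⟩ := h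
    refine ⟨_, _, _, rfl, hA.rename ρ, hR _ _ hM, ?_⟩
    rw [← Fam.rename_inst]
    exact ih h

namespace Derivable

/-- Weakening. Validity of the target is assumed, since it may contain declarations on which `Γ` has
no bearing. -/
theorem rename {J : Judgment} (h : Derivable J) :
    J.Holds (fun _ => True) (fun _ _ => True)
      (fun Γ A => ∀ Γ' ρ, Ctx.Renames Γ Γ' ρ → Derivable (.ctx Γ') →
        Derivable (.fam Γ' (A.rename ρ) .type))
      (fun Γ M A => ∀ Γ' ρ, Ctx.Renames Γ Γ' ρ → Derivable (.ctx Γ') →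
        Derivable (.obj Γ' (M.rename ρ) (A.rename ρ))) := by
  refine h.ind' ?_ ?_ ?_ ?_
  · intro Γ A B _ _ ih₁ ih₂ Γ' ρ hρ hΓ'
    have hA := ih₁ Γ' ρ hρ hΓ'
    exact .piFam hA (ih₂ _ _ (hρ.up A) (.typeCtx hA hΓ'))
  · intro Γ u K Ms _ hu hs Γ' ρ hρ hΓ'
    rw [Fam.rename_apps]
    refine fam_app hΓ' (hρ.fam _ _ hu) ?_
    rw [Kind.toFam_rename]
    exact hs.rename (Q := .con u) fun M A h => h.2.2 Γ' ρ hρ hΓ'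
  · intro Γ A B M _ _ ih₁ ih₂ Γ' ρ hρ hΓ'
    have hA := ih₁ Γ' ρ hρ hΓ'
    exact .absObj hA (ih₂ _ _ (hρ.up A) (.typeCtx hA hΓ'))
  · intro Γ y C Q Ms hΓ hy hs hQ Γ' ρ hρ hΓ'
    rw [Obj.rename_apps]
    have hL := (obj_app hΓ hy (hs.imp fun _ _ _ h => h.1) hQ).obj_long.2
    exact obj_app hΓ' (hρ.obj _ _ hy) (hs.rename fun M A h => h.2.2 Γ' ρ hρ hΓ')
      (hL.rename fun _ _ => hρ.arities).normal

theorem fam_of_hasObj {Γ : Ctx} (h : Derivable (.ctx Γ)) {x : ℕ} {A : Fam}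
    (hx : Ctx.HasObj Γ x A) : Derivable (.fam Γ A .type) := by
  induction hx with
  | here Γ A =>
    exact h.ctx_obj_inv.1.rename rfl _ _
      ⟨fun _ _ h => .there_obj _ h, fun _ _ h => .there_obj _ h⟩ h
  | there_obj B _ ih =>
    exact (ih h.ctx_obj_inv.2).rename rfl _ _
      ⟨fun _ _ h => .there_obj _ h, fun _ _ h => .there_obj _ h⟩ h
  | @there_fam Γ x A u K _ ih =>
    have := (ih h.ctx_fam_inv.2.1).rename rfl (.fam u K :: Γ) (fun x => x)
      ⟨fun _ A h => by rw [Fam.rename_id]; exact .there_fam _ _ h,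
        fun _ L h => by rw [Kind.rename_id]; exact .there_fam _ _ h⟩ h
    rwa [Fam.rename_id] at this

end Derivable

/-! ### The type constants of a family -/

/-- Objects mention no type constants, so arguments are skipped. The predicate is needed because a
removed part of a context may declare type constants as well as variables. -/
def Fam.ConstsIn (S : Set ℕ) : Fam → Prop
  | con u => u ∈ S
  | pi A B => A.ConstsIn S ∧ B.ConstsIn S
  | lam A B => A.ConstsIn S ∧ B.ConstsIn S
  | app A _ => A.ConstsIn S

namespace Fam

theorem constsIn_subst {S : Set ℕ} {A : Fam} {σ : ℕ → Obj} :
    (A.subst σ).ConstsIn S ↔ A.ConstsIn S := by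
  induction A generalizing σ <;> simp_all [subst, ConstsIn]

theorem constsIn_rename {S : Set ℕ} {A : Fam} {ρ : ℕ → ℕ} :
    (A.rename ρ).ConstsIn S ↔ A.ConstsIn S := by
  rw [rename_eq_subst, constsIn_subst]

theorem Red.constsIn {S : Set ℕ} {A B : Fam} (h : Red A B) : B.ConstsIn S ↔ A.ConstsIn S := by
  induction h <;> simp_all [ConstsIn]

theorem ConstsIn.mono {S S' : Set ℕ} {A : Fam} (h : A.ConstsIn S) (hS : S ⊆ S') :
    A.ConstsIn S' := by
  induction A with
  | con u => exact hS h
  | pi A B ih₁ ih₂ | lam A B ih₁ ih₂ => exact ⟨ih₁ h.1, ih₂ h.2⟩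
  | app A M ih => exact ih h

theorem constsIn_con_apps {S : Set ℕ} {u : ℕ} {Ms : List Obj} :
    ((con u).apps Ms).ConstsIn S ↔ u ∈ S := by
  induction Ms using List.reverseRecOn with
  | nil => rfl
  | append_singleton Ms M ih => rw [apps_append_singleton]; exact ih

end Fam

def Ctx.consts (Γ : Ctx) : Set ℕ := {u | ∃ K, Ctx.HasFam Γ u K}

theorem Ctx.consts_obj (A : Fam) (Γ : Ctx) : Ctx.consts (.obj A :: Γ) = Ctx.consts Γ := by
  ext u
  constructor
  · rintro ⟨_, _ | ⟨_, h⟩⟩; exact ⟨_, h⟩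
  · rintro ⟨_, h⟩; exact ⟨_, .there_obj _ h⟩

theorem Ctx.consts_subset_fam (u : ℕ) (K : Kind) (Γ : Ctx) :
    Ctx.consts Γ ⊆ Ctx.consts (.fam u K :: Γ) :=
  fun _ ⟨L, h⟩ => ⟨L, .there_fam _ _ h⟩

/-- A coded kind ends in its own constant `v`, which need not be declared yet; hence the
quantification over larger sets `S` containing `v`. -/
theorem Derivable.constsIn {J : Judgment} (h : Derivable J) :
    J.Holds (fun Γ => (∀ x A, Ctx.HasObj Γ x A → A.ConstsIn Γ.consts) ∧
      ∀ u K, Ctx.HasFam Γ u K → ∀ S, Γ.consts ⊆ S → ∀ v ∈ S, (K.toFam v).ConstsIn S)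
      (fun Γ K => ∀ S, Γ.consts ⊆ S → ∀ v ∈ S, (K.toFam v).ConstsIn S)
      (fun Γ A => A.ConstsIn Γ.consts) (fun _ _ _ => True) := by
  refine h.ind ?_ ?_ ?_ ?_ ?_ ?_ ?_ ?_ ?_
  · exact ⟨by rintro _ _ ⟨⟩, by rintro _ _ ⟨⟩⟩
  · intro Γ u K _ _ _ ih₁ ih₂
    have hsub := Ctx.consts_subset_fam u K Γ
    refine ⟨?_, ?_⟩
    · rintro x A (_ | _ | ⟨_, _, h⟩); exact (ih₂.1 _ _ h).mono hsub
    · rintro x A (_ | _ | ⟨_, _, h⟩) S hS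
      · exact ih₁ S (hsub.trans hS)
      · exact ih₂.2 _ _ h S (hsub.trans hS)
  · intro Γ A _ _ ih₁ ih₂
    rw [Ctx.consts_obj]
    refine ⟨?_, ?_⟩
    · rintro x A (_ | ⟨_, h⟩)
      · exact Fam.constsIn_rename.2 ih₁
      · exact Fam.constsIn_rename.2 (ih₂.1 _ _ h)
    · rintro x A (_ | ⟨_, h⟩) S hS v hv
      rw [Kind.toFam_rename]
      exact Fam.constsIn_rename.2 (ih₂.2 _ _ h S hS v hv)
  · exact fun Γ _ _ S _ v hv => hv
  · intro Γ A K _ _ ih₁ ih₂ S hS v hv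
    exact ⟨ih₁.mono hS, ih₂ S (by rwa [Ctx.consts_obj]) v hv⟩
  · intro Γ A B _ _ ih₁ ih₂
    rw [Ctx.consts_obj] at ih₂
    exact ⟨ih₁, ih₂⟩
  · exact fun Γ u K Ms _ _ hu _ => Fam.constsIn_con_apps.2 ⟨K, hu⟩
  · exact fun _ _ _ _ _ _ _ _ => trivial
  · exact fun _ _ _ _ _ _ _ _ _ _ => trivial

/-! ### Strengthening -/

theorem Fam.Step.rename {A B : Fam} (h : Step A B) (ρ : ℕ → ℕ) :
    Step (A.rename ρ) (B.rename ρ) := by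
  induction h generalizing ρ with
  | beta A B N => rw [rename_inst]; exact .beta _ _ _
  | piL _ _ ih => exact .piL _ (ih _)
  | piR _ _ ih => exact .piR _ (ih _)
  | lamL _ _ ih => exact .lamL _ (ih _)
  | lamR _ _ ih => exact .lamR _ (ih _)
  | appL _ _ ih => exact .appL _ (ih _)
  | appR _ h => exact .appR _ (h.rename ρ)

/-- `ρ` is an injective renaming such that the declarations in `Γ'` of its values and of the
constants in `S` come from declarations of `Γ`. -/
structure Ctx.Reflects (S : Set ℕ) (Γ Γ' : Ctx) (ρ : ℕ → ℕ) : Prop where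
  inj : Function.Injective ρ
  obj : ∀ x A', Ctx.HasObj Γ' (ρ x) A' → ∃ A, Ctx.HasObj Γ x A ∧ A' = A.rename ρ
  fam : ∀ u ∈ S, ∀ K', Ctx.HasFam Γ' u K' → ∃ K, Ctx.HasFam Γ u K ∧ K' = K.rename ρ
  constsIn_obj : ∀ x A, Ctx.HasObj Γ x A → A.ConstsIn S
  constsIn_fam : ∀ u ∈ S, ∀ K, Ctx.HasFam Γ u K → (K.toFam u).ConstsIn S

/-- Common core of `up` and `extend`, which differ in where the new variable goes and in whether the
target context grows. -/
theorem Ctx.Reflects.cons {S : Set ℕ} {Γ Γ' : Ctx} {ρ : ℕ → ℕ} (h : Ctx.Reflects S Γ Γ' ρ)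
    {A E : Fam} (hA : A.ConstsIn S) {Γ'' : Ctx} {ρ' : ℕ → ℕ} (hinj : Function.Injective ρ')
    (hE : ∀ E', Ctx.HasObj Γ'' (ρ' 0) E' → E' = E) (hEA : E = (A.rename Nat.succ).rename ρ')
    (hobj : ∀ x B', Ctx.HasObj Γ'' (ρ' (x + 1)) B' → ∃ B, Ctx.HasObj Γ x B ∧
      B' = (B.rename Nat.succ).rename ρ')
    (hfam : ∀ u ∈ S, ∀ K', Ctx.HasFam Γ'' u K' → ∃ K, Ctx.HasFam Γ u K ∧
      K' = (K.rename Nat.succ).rename ρ') :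
    Ctx.Reflects S (.obj A :: Γ) Γ'' ρ' where
  inj := hinj
  obj := by
    intro x B' hx
    cases x with
    | zero => exact ⟨_, .here _ _, (hE _ hx).trans hEA⟩
    | succ x =>
      obtain ⟨B, hB, rfl⟩ := hobj x B' hx
      exact ⟨_, .there_obj _ hB, rfl⟩
  fam := by
    intro u hu K' hK
    obtain ⟨K, hK', rfl⟩ := hfam u hu K' hK
    exact ⟨_, .there_obj _ hK', rfl⟩
  constsIn_obj := by
    rintro _ _ (_ | ⟨_, hx⟩)
    · exact Fam.constsIn_rename.2 hA
    · exact Fam.constsIn_rename.2 (h.constsIn_obj _ _ hx)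
  constsIn_fam := by
    rintro u hu _ (_ | ⟨_, hx⟩)
    rw [Kind.toFam_rename]
    exact Fam.constsIn_rename.2 (h.constsIn_fam _ hu _ hx)

theorem Ctx.Reflects.up {S : Set ℕ} {Γ Γ' : Ctx} {ρ : ℕ → ℕ} (h : Ctx.Reflects S Γ Γ' ρ)
    {A : Fam} (hA : A.ConstsIn S) :
    Ctx.Reflects S (.obj A :: Γ) (.obj (A.rename ρ) :: Γ') (upRen ρ) := by
  refine h.cons hA (upRen_injective h.inj) ?_ (Fam.rename_succ_rename A ρ) ?_ ?_
  · rintro _ ⟨⟩; rfl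
  · rintro x _ (_ | ⟨_, hx⟩)
    obtain ⟨B, hB, rfl⟩ := h.obj _ _ hx
    exact ⟨B, hB, Fam.rename_succ_rename B ρ⟩
  · rintro u hu _ (_ | ⟨_, hx⟩)
    obtain ⟨K, hK, rfl⟩ := h.fam _ hu _ hx
    exact ⟨K, hK, Kind.rename_succ_rename K ρ⟩

/-- Extension by a declaration that is mapped to a variable outside the range of `ρ`. -/
theorem Ctx.Reflects.extend {S : Set ℕ} {Γ Γ' : Ctx} {ρ : ℕ → ℕ} (h : Ctx.Reflects S Γ Γ' ρ)
    {A : Fam} (hA : A.ConstsIn S) {y : ℕ} (hy : Ctx.HasObj Γ' y (A.rename ρ))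
    (hne : ∀ x, ρ x ≠ y) :
    Ctx.Reflects S (.obj A :: Γ) Γ' (fun x => Nat.casesOn x y ρ) := by
  refine h.cons hA ?_ (fun E' hE => hE.unique hy) (Fam.rename_rename A Nat.succ fun x => Nat.casesOn x y ρ).symm ?_ ?_
  · intro a b hab
    cases a <;> cases b
    · rfl
    · exact absurd hab.symm (hne _)
    · exact absurd hab (hne _)
    · exact congrArg _ (h.inj hab)
  · intro x B' hx
    obtain ⟨B, hB, rfl⟩ := h.obj x B' hx
    exact ⟨B, hB, (Fam.rename_rename B Nat.succ fun x => Nat.casesOn x y ρ).symm⟩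
  · intro u hu K' hK
    obtain ⟨K, hK', rfl⟩ := h.fam u hu K' hK
    exact ⟨K, hK', (Kind.rename_rename K Nat.succ fun x => Nat.casesOn x y ρ).symm⟩

theorem Spine.of_rename {R R' : Obj → Fam → Prop} {C Q : Fam} {Ms : List Obj} {ρ : ℕ → ℕ}
    {S : Set ℕ} (hρ : Function.Injective ρ)
    (h : Spine R (C.rename ρ) (Ms.map (Obj.rename ρ)) (Q.rename ρ)) (hC : C.ConstsIn S)
    (hR : ∀ M A, A.ConstsIn S → R (M.rename ρ) (A.rename ρ) → R' M A) : Spine R' C Ms Q := by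
  induction Ms generalizing C with
  | nil =>
    obtain ⟨Q', hQ, heq⟩ := h.2.of_rename
    rw [Fam.rename_injective hρ heq]
    exact ⟨Fam.atomic_rename.1 h.1, hQ⟩
  | cons M Ms ih =>
    obtain ⟨A, B, A', hAB, hA, hM, h⟩ := h
    cases C with
    | pi C D =>
      simp only [Fam.rename, Fam.pi.injEq] at hAB
      obtain ⟨rfl, rfl⟩ := hAB
      obtain ⟨A', hA', rfl⟩ := hA.of_rename
      refine ⟨C, D, A', rfl, hA', hR _ _ (hA'.constsIn.2 hC.1) hM, ?_⟩
      rw [← Fam.rename_inst] at h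
      exact ih h (Fam.constsIn_subst.2 hC.2)
    | _ => simp [Fam.rename] at hAB

/-- Strengthening. Abstractions carry no labels, so a derivation looks up only variables of its
subject and constants of its types. The argument types come from the declared type of the head,
hence again lie in the image of `ρ` and over `S`. -/
theorem Derivable.of_rename {J : Judgment} (h : Derivable J) :
    J.Holds (fun _ => True) (fun _ _ => True)
      (fun Γ' A' => ∀ S Γ ρ A, A' = A.rename ρ → Ctx.Reflects S Γ Γ' ρ → Derivable (.ctx Γ) →
        A.ConstsIn S → Derivable (.fam Γ A .type))
      (fun Γ' M' A' => ∀ S Γ ρ M A, M' = M.rename ρ → A' = A.rename ρ →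
        Ctx.Reflects S Γ Γ' ρ → Derivable (.ctx Γ) → A.ConstsIn S →
        Derivable (.obj Γ M A)) := by
  refine h.ind' ?_ ?_ ?_ ?_
  · rintro Γ' A' B' _ _ ih₁ ih₂ S Γ ρ A hA hρ hΓ hS
    cases A with
    | pi A B =>
      simp only [Fam.rename, Fam.pi.injEq] at hA
      obtain ⟨rfl, rfl⟩ := hA
      have hA := ih₁ S Γ ρ A rfl hρ hΓ hS.1
      exact .piFam hA (ih₂ S _ _ B rfl (hρ.up hS.1) (.typeCtx hA hΓ) hS.2)
    | _ => simp [Fam.rename] at hA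
  · rintro Γ' u K' Ms' _ hu hs S Γ ρ A hA hρ hΓ hS
    obtain ⟨Ms, rfl, rfl⟩ := Fam.apps_eq_rename hA.symm
    rw [Fam.constsIn_con_apps] at hS
    obtain ⟨K, hK, rfl⟩ := hρ.fam u hS _ hu
    rw [Kind.toFam_rename] at hs
    exact fam_app hΓ hK (hs.of_rename (Q := .con u) hρ.inj (hρ.constsIn_fam _ hS _ hK)
      fun M A hA h => h.2.2 S Γ ρ M A rfl rfl hρ hΓ hA)
  · rintro Γ' A' B' M' _ _ ih₁ ih₂ S Γ ρ M A hM hA hρ hΓ hS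
    cases A with
    | pi A B =>
      simp only [Fam.rename, Fam.pi.injEq] at hA
      obtain ⟨rfl, rfl⟩ := hA
      cases M with
      | lam M =>
        simp only [Obj.rename, Obj.lam.injEq] at hM
        subst hM
        have hA := ih₁ S Γ ρ A rfl hρ hΓ hS.1
        exact .absObj hA (ih₂ S _ _ M B rfl rfl (hρ.up hS.1) (.typeCtx hA hΓ) hS.2)
      | _ => simp [Obj.rename] at hM
    | _ => simp [Fam.rename] at hA
  · rintro Γ' y C' Q' Ms' _ hy hs hQ S Γ ρ M Q hM rfl hρ hΓ hS
    obtain ⟨x, Ms, rfl, rfl, rfl⟩ := Obj.apps_eq_rename hM.symm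
    obtain ⟨C, hC, rfl⟩ := hρ.obj x _ hy
    exact obj_app hΓ hC (hs.of_rename hρ.inj (hρ.constsIn_obj _ _ hC)
      fun M A hA h => h.2.2 S Γ ρ M A rfl rfl hρ hΓ hA) fun B hB => hQ _ (hB.rename ρ)

/-! ### Lookup in a concatenation of contexts -/

namespace Ctx

theorem numObj_ofTypes (Bs : List Fam) : numObj (ofTypes Bs) = Bs.length := by
  have key : ∀ Γ Δ : Ctx, numObj (Γ ++ Δ) = numObj Γ + numObj Δ := by
    intro Γ Δ
    induction Γ with
    | nil => simp [numObj]
    | cons D Γ ih => cases D <;> simp [numObj, ih]; omega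
  induction Bs with
  | nil => rfl
  | cons B Bs ih =>
    have : ofTypes (B :: Bs) = ofTypes Bs ++ [.obj B] := by simp [ofTypes]
    rw [this, key, ih]; rfl

theorem ofTypes_cons_append (B : Fam) (Bs : List Fam) (Γ : Ctx) :
    ofTypes (B :: Bs) ++ Γ = ofTypes Bs ++ .obj B :: Γ := by
  simp [ofTypes]

theorem HasObj.append {Γ : Ctx} {x : ℕ} {A : Fam} (h : HasObj Γ x A) (Ξ : Ctx) :
    HasObj (Ξ ++ Γ) (x + numObj Ξ) (A.rename (· + numObj Ξ)) := by
  induction Ξ with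
  | nil => simpa [numObj, Fam.rename_id] using h
  | cons D Ξ ih =>
    cases D with
    | obj B =>
      have := HasObj.there_obj B ih
      rw [Fam.rename_rename] at this
      exact this
    | fam u K => exact .there_fam u K ih

theorem HasObj.append_inv {Γ Ξ : Ctx} {x : ℕ} {A : Fam}
    (h : HasObj (Ξ ++ Γ) (x + numObj Ξ) A) :
    ∃ B, HasObj Γ x B ∧ A = B.rename (· + numObj Ξ) := by
  induction Ξ generalizing A with
  | nil => exact ⟨A, h, by simp [numObj, Fam.rename_id]⟩
  | cons D Ξ ih =>
    cases D with
    | obj B =>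
      cases h with
      | there_obj _ h =>
        obtain ⟨B, hB, rfl⟩ := ih h
        exact ⟨B, hB, by rw [Fam.rename_rename]; rfl⟩
    | fam u K =>
      cases h with
      | there_fam _ _ h => exact ih h

theorem HasFam.append {Γ : Ctx} {u : ℕ} {K : Kind} (h : HasFam Γ u K) (Ξ : Ctx) :
    HasFam (Ξ ++ Γ) u (K.rename (· + numObj Ξ)) := by
  induction Ξ with
  | nil => simpa [numObj, Kind.rename_id] using h
  | cons D Ξ ih =>
    cases D with
    | obj B =>
      have := HasFam.there_obj B ih
      rw [Kind.rename_rename] at this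
      exact this
    | fam u K => exact .there_fam u K ih

end Ctx

theorem Derivable.ctx_append_right {Ξ Γ : Ctx} (h : Derivable (.ctx (Ξ ++ Γ))) :
    Derivable (.ctx Γ) := by
  induction Ξ with
  | nil => exact h
  | cons D Ξ ih =>
    cases D with
    | obj A => exact ih h.ctx_obj_inv.2
    | fam u K => exact ih h.ctx_fam_inv.2.1

/-! ### Types of eta-expanded variables -/

theorem Derivable.lams_inv {Γ : Ctx} {m : ℕ} {M : Obj} {A : Fam}
    (h : Derivable (.obj Γ (Obj.lams m M) A)) :
    ∃ As Q, As.length = m ∧ A = Fam.pis As Q ∧ Derivable (.obj (Ctx.ofTypes As ++ Γ) M Q) := by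
  induction m generalizing Γ A with
  | zero => exact ⟨[], A, rfl, rfl, h⟩
  | succ m ih =>
    obtain ⟨A₁, A₂, rfl, _, h⟩ := Derivable.lam_inv h
    obtain ⟨As, Q, rfl, rfl, h⟩ := ih h
    exact ⟨A₁ :: As, Q, rfl, rfl, by rwa [Ctx.ofTypes_cons_append]⟩

/-- Every argument is an expanded bound variable, whose only type is its declaration in `As`; so the
domains of `C` are the binder types one after the other. Passing a binder moves it from `As` into
`G`. -/
theorem Spine.eq_pis {F G : Ctx} {As : List Fam} {C Q : Fam} {Ms : List Obj}
    (hF : F = Ctx.ofTypes As ++ G) (hlen : Ms.length = As.length)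
    (h : Spine (fun M A => Derivable (.obj F M A)) (C.rename (· + As.length)) Ms Q)
    (hC : C.Long (Ctx.arities G)) (hQ : Q.Normal)
    (hMs : ∀ (j : ℕ) (h : j < Ms.length), EtaVar (Ms.length - 1 - j) Ms[j] ∧
      ∀ A, Derivable (.obj F Ms[j] A) → Ctx.HasObj F (Ms.length - 1 - j) A) :
    C = Fam.pis As Q := by
  induction As generalizing G C Ms with
  | nil =>
    obtain rfl := List.length_eq_zero_iff.1 hlen
    have : C.rename (· + 0) = C := Fam.rename_id C
    rw [List.length_nil, this] at h
    exact (h.2.eq_of_normal hC.normal).symm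
  | cons A As ih =>
    cases Ms with
    | nil => simp at hlen
    | cons M Ms =>
      simp only [List.length_cons, Nat.add_right_cancel_iff] at hlen
      obtain ⟨C₁, C₂, A', hC', hA, hM, h⟩ := h
      cases C with
      | pi C D =>
        simp only [Fam.rename, Fam.pi.injEq] at hC'
        obtain ⟨rfl, rfl⟩ := hC'
        obtain ⟨A', hA', rfl⟩ := hA.of_rename
        obtain rfl := hA'.eq_of_normal hC.1.normal
        obtain ⟨heta, hvar⟩ := hMs 0 (by simp)
        have hx := hvar _ hM
        simp only [List.length_cons, Nat.add_sub_cancel, Nat.sub_zero, hlen] at hx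
        rw [hF, Ctx.ofTypes_cons_append, ← Ctx.numObj_ofTypes As,
          ← Nat.zero_add (Ctx.numObj _)] at hx
        obtain ⟨B, hB, heq⟩ := hx.append_inv
        cases hB
        rw [Fam.rename_rename, Ctx.numObj_ofTypes] at heq
        have hinj : Function.Injective fun x : ℕ => x + (A :: As).length :=
          add_left_injective _
        have heq' : A'.rename (fun x : ℕ => x + (A :: As).length) =
            A.rename (fun x : ℕ => x + (A :: As).length) := by
          refine Eq.trans ?_ (heq.trans ?_) <;>
            (congr 1; funext x; simp only [List.length_cons]; omega)
        obtain rfl := Fam.rename_injective hinj heq'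
        have hMeta := (heta.eq_eta hM.obj_long.1).2
        simp only [List.getElem_cons_zero, List.length_cons, Nat.add_sub_cancel, Nat.sub_zero,
          Fam.arity_rename, hlen] at hMeta
        rw [Fam.rename_upRen_inst] at h
        -- The argument is the expansion of variable `As.length`, and the other variables are
        -- shifted by one more; together this is the shift by `As.length` of the codomain.
        have hred := hC.2.subst_eta (ρ := (· + As.length))
          (σ := scons M fun x => .var (x + (A' :: As).length)) (by
            intro x c hx
            cases x with
            | zero =>
              simp only [List.getElem?_cons_zero, Option.some.injEq] at hx
              subst hx
              exact .inr (by simpa [scons] using hMeta)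
            | succ x => exact .inl (by simp only [scons, List.length_cons]; congr 1; omega))
        rw [ih (G := .obj A' :: G) (hF.trans (Ctx.ofTypes_cons_append _ _ _)) hlen
          (h.red hred (fun _ _ h => h.obj_normal) hQ) hC.2 ?_]
        · rfl
        · intro j hj
          have := hMs (j + 1) (by simpa using hj)
          have e : (M :: Ms).length - 1 - (j + 1) = Ms.length - 1 - j := by
            simp only [List.length_cons]; omega
          rwa [e] at this
      | _ => simp [Fam.rename] at hC'

/-- Inversion exposes binder types `As` and target `Q`; by induction on the arguments `Spine.eq_pis`
applies, so the declared type of the head is the whole product and nothing is lost by expanding. -/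
theorem EtaVar.hasObj {y : ℕ} {M : Obj} (hM : EtaVar y M) {Γ : Ctx} {A : Fam}
    (h : Derivable (.obj Γ M A)) : Ctx.HasObj Γ y A := by
  induction hM generalizing Γ A with
  | mk y Ms hMs ih =>
    obtain ⟨As, Q, hlen, rfl, h'⟩ := h.lams_inv
    obtain ⟨C, hC, hs⟩ := h'.app_inv
    rw [← hlen, ← Ctx.numObj_ofTypes] at hC
    obtain ⟨C, hC', rfl⟩ := hC.append_inv
    rw [Ctx.numObj_ofTypes] at hs
    rw [← hs.eq_pis rfl hlen.symm (h.obj_ctx.hasObj_long hC') h'.obj_normal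
      fun j hj => ⟨hMs j hj, fun A => ih j hj⟩]
    exact hC'

/-! ### Instances of contexts -/

theorem ups_of_lt {k y : ℕ} (τ : ℕ → Obj) (h : y < k) : ups k τ y = .var y := by
  induction k generalizing y with
  | zero => omega
  | succ k ih =>
    cases y with
    | zero => rfl
    | succ y => simp [ups, up, ih (Nat.lt_of_succ_lt_succ h), Obj.rename]

theorem ups_add (k y : ℕ) (τ : ℕ → Obj) : ups k τ (y + k) = (τ y).rename (· + k) := by
  induction k with
  | zero => exact (Obj.rename_id _).symm
  | succ k ih =>
    have : ups (k + 1) τ (y + (k + 1)) = (ups k τ (y + k)).rename Nat.succ := rfl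
    rw [this, ih, Obj.rename_rename]; rfl

theorem inst_add_length (Ns : List Obj) (x : ℕ) : inst Ns (x + Ns.length) = .var x := by
  rw [inst, List.getD_eq_default _ _ (by simp), Nat.add_sub_cancel]

/-- A type that does not see the innermost variables is instantiated by an initial segment only;
this is the origin of `Ns.take i` in the conclusion. -/
theorem inst_add_sub (Ns : List Obj) {i : ℕ} (hi : i ≤ Ns.length) (x : ℕ) :
    inst Ns (x + (Ns.length - i)) = inst (Ns.take i) x := by
  have h : Ns.reverse = (Ns.drop i).reverse ++ (Ns.take i).reverse := by
    rw [← List.reverse_append, List.take_append_drop]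
  have e₁ : x + (Ns.length - i) - Ns.length = x - i := by omega
  simp only [inst, h, List.getD_eq_getElem?_getD]
  rw [List.getElem?_append_right (by simp), e₁]
  simp [Nat.min_eq_left hi]

theorem inst_getElem (Ns : List Obj) {i : ℕ} (hi : i < Ns.length) :
    inst Ns (Ns.length - 1 - i) = Ns[i] := by
  have e : Ns.length - 1 - (Ns.length - 1 - i) = i := by omega
  rw [inst, List.getD_eq_getElem?_getD, List.getElem?_reverse (by omega), e,
    List.getElem?_eq_getElem hi]
  rfl

theorem longSubst_inst {Θ : List Arity} {Ns : List Obj} {as : List Arity}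
    (h : List.Forall₂ (Obj.Long Θ) Ns as) : Obj.LongSubst (as.reverse ++ Θ) Θ (inst Ns) := by
  intro x c hx
  have hlen := h.length_eq
  rcases lt_or_ge x Ns.length with hlt | hge
  · right
    rw [List.getElem?_append_left (by simpa [← hlen] using hlt),
      List.getElem?_reverse (by omega), List.getElem?_eq_getElem (by omega),
      Option.some.injEq] at hx
    obtain ⟨j, hj, rfl⟩ : ∃ j, j < Ns.length ∧ x = Ns.length - 1 - j :=
      ⟨Ns.length - 1 - x, by omega, by omega⟩
    have e : as.length - 1 - (Ns.length - 1 - j) = j := by omega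
    simp only [e] at hx
    rw [inst_getElem Ns hj, ← hx]
    exact h.get hj (hlen ▸ hj)
  · left
    obtain ⟨y, rfl⟩ := Nat.exists_eq_add_of_le' hge
    refine ⟨y, inst_add_length Ns y, ?_⟩
    rw [List.getElem?_append_right (by simp; omega)] at hx
    simpa [← hlen] using hx

namespace Ctx

theorem arities_ofTypes_append (Bs : List Fam) (Γ : Ctx) :
    arities (ofTypes Bs ++ Γ) = (Bs.map Fam.arity).reverse ++ arities Γ := by
  induction Bs generalizing Γ with
  | nil => rfl
  | cons B Bs ih => rw [ofTypes_cons_append, ih]; simp [arities]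

theorem consts_ofTypes_append (Bs : List Fam) (Γ : Ctx) :
    consts (ofTypes Bs ++ Γ) = consts Γ := by
  induction Bs generalizing Γ with
  | nil => rfl
  | cons B Bs ih => rw [ofTypes_cons_append, ih, consts_obj]

theorem HasFam.ofTypes_append_inv {Bs : List Fam} {Γ : Ctx} {u : ℕ} {K : Kind}
    (h : HasFam (ofTypes Bs ++ Γ) u K) :
    ∃ L, HasFam Γ u L ∧ K = L.rename (· + Bs.length) := by
  induction Bs generalizing Γ with
  | nil => exact ⟨K, h, (Kind.rename_id K).symm⟩
  | cons B Bs ih =>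
    rw [ofTypes_cons_append] at h
    obtain ⟨L, hL, rfl⟩ := ih h
    cases hL with
    | there_obj _ hL =>
      refine ⟨_, hL, ?_⟩
      rw [Kind.rename_rename]
      congr 1; funext x; simp only [List.length_cons]; omega

theorem ofTypes_split (Bs : List Fam) {i : ℕ} (hi : i < Bs.length) :
    ofTypes Bs = ofTypes (Bs.drop (i + 1)) ++ .obj Bs[i] :: ofTypes (Bs.take i) := by
  have h : Bs = Bs.take i ++ Bs[i] :: Bs.drop (i + 1) := by
    rw [← List.drop_eq_getElem_cons hi, List.take_append_drop]
  have h' : ofTypes Bs = ofTypes (Bs.take i ++ Bs[i] :: Bs.drop (i + 1)) := by rw [← h]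
  rw [h']
  simp only [ofTypes, List.map_append, List.map_cons, List.reverse_append, List.reverse_cons,
    List.append_assoc, List.singleton_append]

/-- `Red τ Ξ Ξ'`: the declarations of `Ξ'` are reducts of those of the instance of `Ξ` under `τ`. -/
inductive Red (τ : ℕ → Obj) : Ctx → Ctx → Prop
  | nil : Red τ [] []
  | obj {Ξ Ξ' : Ctx} {A A' : Fam} : Red τ Ξ Ξ' → Fam.Red (A.subst (ups (numObj Ξ) τ)) A' →
      Red τ (.obj A :: Ξ) (.obj A' :: Ξ')
  | fam {Ξ Ξ' : Ctx} (u : ℕ) {K K' : Kind} : Red τ Ξ Ξ' →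
      Fam.Red ((K.toFam u).subst (ups (numObj Ξ) τ)) (K'.toFam u) →
      Red τ (.fam u K :: Ξ) (.fam u K' :: Ξ')

theorem Red.numObj {τ : ℕ → Obj} {Ξ Ξ' : Ctx} (h : Red τ Ξ Ξ') :
    Ctx.numObj Ξ' = Ctx.numObj Ξ := by
  induction h <;> simp_all [Ctx.numObj]

theorem NF.red {τ : ℕ → Obj} {Ξ Ξ' Γ : Ctx} (h : NF (Ctx.subst τ Ξ) Ξ')
    (hΓ : Derivable (.ctx (Ξ ++ Γ))) : Red τ Ξ Ξ' := by
  induction Ξ generalizing Ξ' with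
  | nil => cases h; exact .nil
  | cons D Ξ ih =>
    cases D with
    | obj A =>
      cases h with
      | cons h₁ h₂ =>
        cases h₁ with
        | obj h₁ =>
          have hΓ' := Derivable.ctx_obj_inv hΓ
          exact .obj (ih h₂ hΓ'.2)
            ((Fam.noLam_subst.2 hΓ'.1.fam_long.noLam).red_of_steps h₁.1)
    | fam u K =>
      cases h with
      | cons h₁ h₂ =>
        cases h₁ with
        | fam _ h₁ =>
          refine .fam u (ih h₂ (Derivable.ctx_fam_inv hΓ).2.1) ?_
          rw [← Kind.toFam_subst]
          refine h₁.red u ?_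
          rw [Kind.toFam_subst]
          exact Fam.noLam_subst.2 (hΓ.noLam.2 _ _ (.here _ _ _) u)

/-- Lookup of a variable declared in the instantiated context. -/
theorem Red.hasObj_of_lt {τ : ℕ → Obj} {Ξ Ξ' Γ Γ' : Ctx} (h : Red τ Ξ Ξ') {y : ℕ} {C : Fam}
    (hy : y < Ctx.numObj Ξ) (hC : HasObj (Ξ ++ Γ) y C) :
    ∃ C', HasObj (Ξ' ++ Γ') y C' ∧ Fam.Red (C.subst (ups (Ctx.numObj Ξ) τ)) C' := by
  have hup : ∀ (B : Fam) (σ : ℕ → Obj),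
      (B.rename Nat.succ).subst (up σ) = (B.subst σ).rename Nat.succ := by
    intro B σ; rw [Fam.rename_subst, Fam.subst_rename]; rfl
  induction h generalizing y C with
  | nil => simp [Ctx.numObj] at hy
  | @obj Ξ Ξ' A A' _ hA ih =>
    cases hC with
    | here =>
      refine ⟨_, .here _ _, ?_⟩
      rw [Ctx.numObj, ups, hup]
      exact hA.rename _
    | there_obj _ hC =>
      obtain ⟨C', hC', hr⟩ := ih (by simpa [Ctx.numObj] using hy) hC
      refine ⟨_, .there_obj _ hC', ?_⟩
      rw [Ctx.numObj, ups, hup]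
      exact hr.rename _
  | fam u _ _ ih =>
    cases hC with
    | there_fam _ _ hC =>
      obtain ⟨C', hC', hr⟩ := ih hy hC
      exact ⟨_, .there_fam _ _ hC', hr⟩

/-! ### Declarations that are not instantiated -/

section Instance

variable {Γ Ξ Ξ' : Ctx} {Bs : List Fam} {Ns : List Obj}

/-- Lookup of a variable that is not instantiated. -/
theorem Red.hasObj (h : Red (inst Ns) Ξ Ξ') (hlen : Ns.length = Bs.length)
    (hΓ : Derivable (.ctx Γ)) {y : ℕ} {C : Fam}
    (hy : Ctx.numObj Ξ ≤ y → y < Ctx.numObj Ξ + Bs.length → False)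
    (hC : HasObj (Ξ ++ (ofTypes Bs ++ Γ)) y C) :
    ∃ y' C', ups (Ctx.numObj Ξ) (inst Ns) y = .var y' ∧ HasObj (Ξ' ++ Γ) y' C' ∧
      Fam.Red (C.subst (ups (Ctx.numObj Ξ) (inst Ns))) C' := by
  rcases lt_or_ge y (Ctx.numObj Ξ) with hlt | hge
  · obtain ⟨C', hC', hr⟩ := h.hasObj_of_lt (Γ' := Γ) hlt hC
    exact ⟨y, C', ups_of_lt _ hlt, hC', hr⟩
  · obtain ⟨z, rfl⟩ := Nat.exists_eq_add_of_le' hge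
    obtain ⟨w, rfl⟩ := Nat.exists_eq_add_of_le' (show Bs.length ≤ z by
      by_contra hlt; exact hy hge (by omega))
    obtain ⟨C₁, hC₁, rfl⟩ := hC.append_inv
    rw [← numObj_ofTypes Bs] at hC₁
    obtain ⟨C, hC', rfl⟩ := hC₁.append_inv
    refine ⟨w + Ctx.numObj Ξ, C.rename (· + Ctx.numObj Ξ), ?_, ?_, ?_⟩
    · rw [ups_add, ← hlen, inst_add_length]; rfl
    · rw [← h.numObj]; exact hC'.append Ξ'
    · have : ((C.rename (· + Ctx.numObj (ofTypes Bs))).rename (· + Ctx.numObj Ξ)).subst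
          (ups (Ctx.numObj Ξ) (inst Ns)) = C.rename (· + Ctx.numObj Ξ) := by
        rw [Fam.rename_subst, Fam.rename_subst, Fam.rename_eq_subst]
        congr 1; funext x
        rw [ups_add, numObj_ofTypes, ← hlen, inst_add_length]; rfl
      rw [this]
      exact (Fam.noLam_rename.2 (hΓ.hasObj_long hC').noLam).red_refl

/-- The constant is declared either in the local part, whose declarations are instantiated, or in
`Γ`, on which the substitution acts trivially. -/
theorem Red.hasFam (h : Red (inst Ns) Ξ Ξ') (hlen : Ns.length = Bs.length)
    (hΓ : Derivable (.ctx Γ)) {u : ℕ} {K : Kind} (hK : HasFam (Ξ ++ (ofTypes Bs ++ Γ)) u K) :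
    ∃ K', HasFam (Ξ' ++ Γ) u K' ∧
      Fam.Red ((K.toFam u).subst (ups (Ctx.numObj Ξ) (inst Ns))) (K'.toFam u) := by
  have hup : ∀ (B : Fam) (σ : ℕ → Obj),
      (B.rename Nat.succ).subst (up σ) = (B.subst σ).rename Nat.succ := by
    intro B σ; rw [Fam.rename_subst, Fam.subst_rename]; rfl
  induction h generalizing K with
  | nil =>
    obtain ⟨L, hL, rfl⟩ := HasFam.ofTypes_append_inv hK
    refine ⟨L, hL, ?_⟩
    have : ((L.rename (· + Bs.length)).toFam u).subst (ups 0 (inst Ns)) = L.toFam u := by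
      rw [Kind.toFam_rename, Fam.rename_subst]
      conv_rhs => rw [← Fam.subst_var (L.toFam u)]
      congr 1; funext x
      rw [← hlen]; exact inst_add_length Ns x
    rw [Ctx.numObj, this]
    exact (hΓ.hasFam_long hL u).noLam.red_refl
  | obj _ _ ih =>
    cases hK with
    | there_obj _ hK =>
      obtain ⟨K', hK', hr⟩ := ih hK
      refine ⟨_, .there_obj _ hK', ?_⟩
      rw [Ctx.numObj, ups, Kind.toFam_rename, Kind.toFam_rename, hup]
      exact hr.rename _
  | fam v _ hr ih =>
    cases hK with
    | here => exact ⟨_, .here _ _ _, hr⟩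
    | there_fam _ _ hK =>
      obtain ⟨K', hK', hr⟩ := ih hK
      exact ⟨_, .there_fam _ _ hK', hr⟩

end Instance

end Ctx

/-! ### Comparison of a derivation with its instance -/

/-- The two spines advance together. Substituting related arguments keeps the remaining codomains
related, and confluence passes the relation on to the normal types of the arguments. -/
theorem Spine.exists_instance {R R' : Obj → Fam → Prop} {σ : ℕ → Obj} {C C' Q Q' : Fam}
    {Ms Ms' : List Obj} (h : Spine R C Ms Q) (h' : Spine R' C' Ms' Q')
    (hC : Fam.Red (C.subst σ) C') (hMs : List.Forall₂ Obj.Red (Ms.map (Obj.subst σ)) Ms')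
    (hR' : ∀ M A, R' M A → A.Normal) {M : Obj} (hM : M ∈ Ms) :
    ∃ M' A A', R M A ∧ R' M' A' ∧ Obj.Red (M.subst σ) M' ∧ Fam.Red (A.subst σ) A' := by
  induction Ms generalizing C C' Ms' with
  | nil => cases hM
  | cons N Ms ih =>
    cases hMs with
    | @cons _ N' _ Ms' hN hMs =>
      obtain ⟨A, B, A₁, rfl, hA, hRN, h⟩ := h
      obtain ⟨A', B', A₁', rfl, hA', hRN', h'⟩ := h'
      cases hC with
      | pi hAA hBB =>
        rcases List.mem_cons.1 hM with rfl | hM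
        · refine ⟨N', A₁, A₁', hRN, hRN', hN, ?_⟩
          exact (hA.subst fun _ => .refl).to_normal (hAA.trans hA') (hR' _ _ hRN')
        · refine ih h h' ?_ hMs hM
          rw [Fam.subst_inst_subst]
          exact hBB.subst (red_inst_singleton hN)

theorem Obj.Red.to_normal {M N L : Obj} (h : Red M N) (h' : Red M L) (hL : ∀ P, ¬ Step L P) :
    Red N L := by
  obtain ⟨P, h₁, h₂⟩ := h.confluent h'
  rwa [h₂.eq_of_normal hL] at h₁

/-- An object is well typed if its application to distinct variables is, the types of these
variables being those of the arguments. -/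
theorem Derivable.of_pattern {G G' : Ctx} {σ : ℕ → Obj} {k : ℕ} (hσ : ∀ y < k, σ y = .var y)
    (hG : ∀ y C, y < k → Ctx.HasObj G y C →
      ∃ C', Ctx.HasObj G' y C' ∧ Fam.Red (C.subst σ) C')
    {T T' : Fam} (hT : Fam.Red (T.subst σ) T') {M' : Obj} (hM' : Derivable (.obj G' M' T'))
    {S : Set ℕ} {ys : List ℕ} {Ms : List Obj} (hys : List.Forall₂ EtaVar ys Ms)
    (hnodup : ys.Nodup) (hlt : ∀ y ∈ ys, y < k) {Γ : Ctx} {ρ : ℕ → ℕ}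
    (hne : ∀ y ∈ ys, ∀ x, ρ x ≠ y) (hΓ : Derivable (.ctx Γ)) (hρ : Ctx.Reflects S Γ G' ρ)
    {C C' : Fam} (hs : Spine (fun M A => Derivable (.obj G M A)) C Ms T)
    (hC : Fam.Red (C.subst σ) (C'.rename ρ)) (hC' : C'.Long (Ctx.arities Γ))
    (hS : C'.ConstsIn S) {N : Obj} (hN : Obj.Long (Ctx.arities Γ) N C'.arity)
    (hred : Obj.Red ((N.rename ρ).apps (Ms.map (Obj.subst σ))) M') :
    Derivable (.obj Γ N C') := by
  induction hys generalizing Γ ρ C C' N with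
  | nil =>
    -- With no variables left, uniqueness of normal forms identifies the renamed `C'` and `N` with
    -- `T'` and `M'`, and strengthening concludes.
    have h₁ := hC.to_normal ((hs.2.subst fun _ => .refl).trans hT) hM'.obj_normal
    obtain ⟨C'', h₂, rfl⟩ := h₁.of_rename
    obtain rfl := h₂.eq_of_normal hC'.normal
    obtain ⟨N', h₃, rfl⟩ := Obj.Red.of_rename hred
    obtain rfl := h₃.eq_of_normal hN.normal
    exact hM'.of_rename S Γ ρ N' C'' rfl rfl hρ hΓ hS
  | @cons y M ys Ms hM hys ih =>
    obtain ⟨A, B, A₀, rfl, hA, hMA, hs⟩ := hs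
    cases C' with
    | pi A' B' =>
      cases hC with
      | pi hAA hBB =>
        obtain ⟨R, rfl, hR⟩ := hN.arr_inv
        have hy := hlt y (by simp)
        -- The argument is `y` up to expansion, so `A₀` is the declared type of `y`. The normal
        -- declaration of `y` in `G'` must then be the renamed domain of `C'`.
        obtain ⟨E, hE, hr⟩ := hG y A₀ hy (hM.hasObj hMA)
        have hEnormal := (hM'.obj_ctx.hasObj_long hE).normal
        obtain ⟨A'', h₁, rfl⟩ :=
          (hAA.to_normal ((hA.subst fun _ => .refl).trans hr) hEnormal).of_rename
        obtain rfl := h₁.eq_of_normal hC'.1.normal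
        have hA'' : Derivable (.fam Γ A'' .type) :=
          (hM'.obj_ctx.fam_of_hasObj hE).of_rename rfl S Γ ρ A'' rfl hρ hΓ hS.1
        have harity : A₀.arity = A''.arity := by
          rw [hA.arity, ← A.arity_subst σ, ← hAA.arity, Fam.arity_rename]
        have hMeta : M.subst σ = Obj.eta A''.arity (.var y) := by
          rw [(hM.eq_eta hMA.obj_long.1).2, Obj.eta_subst, harity, Obj.subst, hσ y hy]
        have hsub : ∀ (x : ℕ) (c : Arity),
            (A''.arity :: Ctx.arities Γ)[x]? = some c →
            scons (M.subst σ) (fun x => .var (ρ x)) x = .var (Nat.casesOn x y ρ) ∨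
            scons (M.subst σ) (fun x => .var (ρ x)) x =
              Obj.eta c (.var (Nat.casesOn x y ρ)) := by
          intro x c hx
          cases x with
          | zero =>
            simp only [List.getElem?_cons_zero, Option.some.injEq] at hx
            subst hx
            exact .inr hMeta
          | succ x => exact .inl rfl
        rw [List.nodup_cons] at hnodup
        -- The binder of `N` is sent to `y`: `Γ` grows while `G'` stays fixed. Distinctness of the
        -- variables keeps the remaining ones outside the range of the extended renaming.
        refine .absObj hA'' (ih hnodup.2 (fun z hz => hlt z (by simp [hz]))
          (ρ := fun x => Nat.casesOn x y ρ) ?_ (.typeCtx hA'' hΓ)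
          (hρ.extend hS.1 hE (hne y (by simp))) hs ?_ hC'.2 hS.2 hR ?_)
        · intro z hz x
          cases x with
          | zero => rintro rfl; exact hnodup.1 hz
          | succ x => exact hne z (by simp [hz]) x
        · rw [Fam.subst_inst_subst]
          refine (hBB.subst fun _ => .refl).trans ?_
          rw [Fam.rename_upRen_inst]
          exact hC'.2.subst_eta hsub
        · refine Obj.Red.to_normal ?_ hred hM'.obj_long.1.normal
          have hbeta : Obj.Red (.app (.lam (R.rename (upRen ρ))) (M.subst σ))
              (R.rename fun x => Nat.casesOn x y ρ) := by
            refine .head (.beta _ _) ?_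
            rw [Obj.rename_upRen_inst]
            exact hR.subst_eta hsub
          have happs := hbeta.apps (Ms := Ms.map (Obj.subst σ))
            (List.forall₂_same.2 fun _ _ => .refl)
          exact happs
    | _ => cases hC

/-! ### Following the rigid occurrence -/

section Main

variable {Γ : Ctx} {Bs : List Fam} {Ns : List Obj}

/-- Shifting past the local part lands on the declarations of `Γ`; a constant of `Γ` cannot be
redeclared in `Ξ'`, so its lookup ends in `Γ` too. -/
theorem Ctx.Red.reflects {τ : ℕ → Obj} {Ξ Ξ' : Ctx} (h : Ctx.Red τ Ξ Ξ')
    (hΓ : Derivable (.ctx (Ξ' ++ Γ))) :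
    Ctx.Reflects Γ.consts Γ (Ξ' ++ Γ) (· + Ctx.numObj Ξ) where
  inj := add_left_injective _
  obj := by
    intro x A' hx
    rw [← h.numObj] at hx ⊢
    exact hx.append_inv
  fam := by
    rintro u ⟨K, hK⟩ K' hK'
    refine ⟨K, hK, ?_⟩
    rw [← h.numObj]
    exact hΓ.hasFam_unique hK' (hK.append Ξ')
  constsIn_obj := hΓ.ctx_append_right.constsIn.1
  constsIn_fam := fun u hu K hK =>
    hΓ.ctx_append_right.constsIn.2 u K hK _ subset_rfl u hu

/-- Here `Ξ` is the original local context extended by the binders passed on the path. The two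
inclusions ensure that heads outside `X` are not instantiated and that pattern variables are local.
-/
theorem RigidObj.derivable {X δ : Set ℕ} {x : ℕ} {M : Obj} (hM : RigidObj X δ x M)
    (hlen : Ns.length = Bs.length)
    (hlong : List.Forall₂ (Obj.Long (Ctx.arities Γ)) Ns (Bs.map Fam.arity))
    {i : ℕ} (hiN : i < Ns.length) (hiB : i < Bs.length) {Ξ Ξ' : Ctx}
    (hX : ∀ y, Ctx.numObj Ξ ≤ y → y < Ctx.numObj Ξ + Bs.length → y ∈ X)
    (hδ : ∀ y ∈ δ, y < Ctx.numObj Ξ) (hx : x = Ctx.numObj Ξ + (Bs.length - 1 - i))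
    (hΞ : Ctx.Red (inst Ns) Ξ Ξ') {T T' : Fam} {M' : Obj}
    (h : Derivable (.obj (Ξ ++ (Ctx.ofTypes Bs ++ Γ)) M T))
    (h' : Derivable (.obj (Ξ' ++ Γ) M' T'))
    (hMM' : Obj.Red (M.subst (ups (Ctx.numObj Ξ) (inst Ns))) M')
    (hTT' : Fam.Red (T.subst (ups (Ctx.numObj Ξ) (inst Ns))) T') :
    ∃ B' : Fam, Fam.NF (Bs[i].subst (inst (Ns.take i))) B' ∧ Derivable (.obj Γ Ns[i] B') := by
  induction hM generalizing Ξ Ξ' T T' M' with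
  | @init X δ x ys Ms hnodup hys hMs =>
    have hΓ : Derivable (.ctx Γ) := h'.obj_ctx.ctx_append_right
    obtain ⟨C, hC, hs⟩ := h.app_inv
    have hctx := h.obj_ctx.ctx_append_right
    rw [Ctx.ofTypes_split Bs hiB, List.append_assoc] at hctx
    have hB := hctx.ctx_append_right.ctx_obj_inv.1
    have hBlong := hB.fam_long
    have hBconsts := hB.constsIn rfl
    simp only [List.append_eq] at hBlong hBconsts
    rw [Ctx.arities_ofTypes_append] at hBlong
    rw [Ctx.consts_ofTypes_append] at hBconsts
    have hlong' : List.Forall₂ (Obj.Long (Ctx.arities Γ)) (Ns.take i)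
        ((Bs.take i).map Fam.arity) := by
      rw [List.map_take]; exact List.forall₂_take i hlong
    -- The normal form of the instance of `B_i` exists by arities alone, without any typing of the
    -- preceding objects.
    obtain ⟨B', hr, hB'⟩ := hBlong.subst (longSubst_inst hlong')
    refine ⟨B', hB'.nf hr, ?_⟩
    have hC₀ : C = ((Bs[i].rename Nat.succ).rename (· + (Bs.length - (i + 1)))).rename
        (· + Ctx.numObj Ξ) := by
      rw [hx, Nat.add_comm] at hC
      obtain ⟨C₁, hC₁, rfl⟩ := hC.append_inv
      rw [Ctx.ofTypes_split Bs hiB, List.append_assoc] at hC₁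
      have e : Bs.length - 1 - i = 0 + Ctx.numObj (Ctx.ofTypes (Bs.drop (i + 1))) := by
        rw [Ctx.numObj_ofTypes, List.length_drop]; omega
      rw [e] at hC₁
      obtain ⟨C₂, hC₂, rfl⟩ := hC₁.append_inv
      cases hC₂
      rw [Ctx.numObj_ofTypes, List.length_drop]
    -- At its use, `B_i` is shifted past its own variable, the later `x_j` and `Ξ`. Instantiation
    -- absorbs the first two shifts and leaves the last.
    have hCsub : C.subst (ups (Ctx.numObj Ξ) (inst Ns)) =
        (Bs[i].subst (inst (Ns.take i))).rename (· + Ctx.numObj Ξ) := by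
      rw [hC₀, Fam.rename_subst, Fam.rename_subst, Fam.rename_subst, Fam.subst_rename]
      congr 1; funext x
      rw [ups_add, ← inst_add_sub Ns hiN.le]
      congr 2; omega
    have hhead : ups (Ctx.numObj Ξ) (inst Ns) x = Ns[i].rename (· + Ctx.numObj Ξ) := by
      rw [hx, Nat.add_comm, ups_add, ← hlen, inst_getElem Ns hiN]
    have hbase := hlong.get hiN (by simpa using hiB)
    rw [Obj.subst_apps, Obj.subst, hhead] at hMM'
    refine Derivable.of_pattern (fun y => ups_of_lt _)
      (fun y C hy hC => hΞ.hasObj_of_lt hy hC) hTT' h' hMs hnodup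
      (fun y hy => hδ y (hys y hy)) ?_ hΓ (hΞ.reflects h'.obj_ctx) hs
      (hCsub ▸ hr.rename _) hB' ?_ ?_ hMM'
    -- The shift takes values from `numObj Ξ` on, whereas pattern variables have smaller indices.
    · intro y hy z
      have := hδ y (hys y hy)
      omega
    · exact hr.constsIn.2 (Fam.constsIn_subst.2 hBconsts)
    · rw [hr.arity, Fam.arity_subst]
      simpa using hbase
  | @app X δ x y M Ms hy hM _ ih =>
    obtain ⟨C, hC, hs⟩ := h.app_inv
    obtain ⟨y', C', hy', hC', hr⟩ := hΞ.hasObj hlen h'.obj_ctx.ctx_append_right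
      (fun h₁ h₂ => hy (hX y h₁ h₂)) hC
    rw [Obj.subst_apps, Obj.subst, hy'] at hMM'
    obtain ⟨Ms', rfl, hMs⟩ := hMM'.apps_var_inv
    obtain ⟨C'', hC'', hs'⟩ := h'.app_inv
    obtain rfl := hC'.unique hC''
    obtain ⟨M', A, A', h₁, h₂, h₃, h₄⟩ :=
      hs.exists_instance hs' hr hMs (fun _ _ h => h.obj_normal) hM
    exact ih hX hδ hx hΞ h₁ h₂ h₃ h₄
  | @abs X δ x M _ ih =>
    obtain ⟨A, B, rfl, _, h⟩ := h.lam_inv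
    obtain ⟨M', rfl, hMM''⟩ := Obj.Red.lam_inv hMM'
    obtain ⟨A', B', rfl, _, h'⟩ := h'.lam_inv
    cases hTT' with
    | pi hA hB =>
      refine ih (Ξ := .obj A :: Ξ) (Ξ' := .obj A' :: Ξ') ?_ ?_ ?_ (.obj hΞ hA) h h' hMM'' hB
      · intro y h₁ h₂
        simp only [Ctx.numObj] at h₁ h₂
        cases y with
        | zero => omega
        | succ y => exact ⟨y, hX y (by omega) (by omega), rfl⟩
      · rintro y (rfl | ⟨y, hy, rfl⟩)
        · simp [Ctx.numObj]
        · simpa [Ctx.numObj] using hδ y hy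
      · simp only [Ctx.numObj]; omega

/-- A product binder enters `X` and not `δ`; this is harmless, since the invariant only asks that
`X` contain the instantiated indices. At a base type the head constant is never instantiated, so its
arguments are compared through its kinds on both sides. -/
theorem RigidFam.derivable {X : Set ℕ} {x : ℕ} {A : Fam} (hA : RigidFam X x A)
    (hlen : Ns.length = Bs.length)
    (hlong : List.Forall₂ (Obj.Long (Ctx.arities Γ)) Ns (Bs.map Fam.arity))
    {i : ℕ} (hiN : i < Ns.length) (hiB : i < Bs.length) {Ξ Ξ' : Ctx}
    (hX : ∀ y, Ctx.numObj Ξ ≤ y → y < Ctx.numObj Ξ + Bs.length → y ∈ X)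
    (hx : x = Ctx.numObj Ξ + (Bs.length - 1 - i))
    (hΞ : Ctx.Red (inst Ns) Ξ Ξ') {A' : Fam}
    (h : Derivable (.fam (Ξ ++ (Ctx.ofTypes Bs ++ Γ)) A .type))
    (h' : Derivable (.fam (Ξ' ++ Γ) A' .type))
    (hAA' : Fam.Red (A.subst (ups (Ctx.numObj Ξ) (inst Ns))) A') :
    ∃ B' : Fam, Fam.NF (Bs[i].subst (inst (Ns.take i))) B' ∧ Derivable (.obj Γ Ns[i] B') := by
  induction hA generalizing Ξ Ξ' A' with
  | @app X x M c Ms hM hrigid =>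
    obtain ⟨K, hK, hs⟩ := h.fam_app_inv
    obtain ⟨K', hK', hr⟩ := hΞ.hasFam hlen h'.fam_ctx.ctx_append_right hK
    rw [Fam.subst_apps] at hAA'
    obtain ⟨Ms', rfl, hMs⟩ := hAA'.con_apps_inv
    obtain ⟨K'', hK'', hs'⟩ := h'.fam_app_inv
    -- The kind used by the instance is the instance of the original kind, as constants are declared
    -- only once.
    obtain rfl := h'.fam_ctx.hasFam_unique hK' hK''
    obtain ⟨M', A, A', h₁, h₂, h₃, h₄⟩ :=
      hs.exists_instance hs' hr hMs (fun _ _ h => h.obj_normal) hM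
    exact hrigid.derivable hlen hlong hiN hiB hX (fun _ h => h.elim) hx hΞ h₁ h₂ h₃ h₄
  | @pi X x A B _ ih =>
    cases hAA' with
    | @pi _ A' _ B' hA hB =>
      refine ih (Ξ := .obj A :: Ξ) (Ξ' := .obj A' :: Ξ') ?_ ?_ (.obj hΞ hA) h.pi_inv.2
        h'.pi_inv.2 hB
      · intro y h₁ h₂
        simp only [Ctx.numObj] at h₁ h₂
        cases y with
        | zero => omega
        | succ y => exact .inr ⟨y, hX y (by omega) (by omega), rfl⟩
      · simp only [Ctx.numObj]; omega

end Main

end CanonicalLF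

/-- The variables `x₁ : B₁, …, xₙ : Bₙ` have, inside `Γ, x₁ : B₁, …, xₙ : Bₙ, Δ`, the indices
`k + n - 1, …, k`, where `k` is the number of object variables of `Δ`; positions `i` in the lists
`Ns` and `Bs` count from `0`. All instances are taken in normal form. -/
theorem theorem2
    (Γ Δ Δ' : CanonicalLF.Ctx) (Bs : List CanonicalLF.Fam) (Ns : List CanonicalLF.Obj)
    (A A' : CanonicalLF.Fam) (hlen : Ns.length = Bs.length)
    (hlong : ∀ (j : ℕ) (h₁ : j < Ns.length) (h₂ : j < Bs.length),
      CanonicalLF.Obj.Long (CanonicalLF.Ctx.arities Γ) Ns[j] Bs[j].arity)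
    (i : ℕ) (hiN : i < Ns.length) (hiB : i < Bs.length)
    (hrigid : CanonicalLF.RigidFam
      (Set.Ico (CanonicalLF.Ctx.numObj Δ) (CanonicalLF.Ctx.numObj Δ + Bs.length))
      (CanonicalLF.Ctx.numObj Δ + (Bs.length - 1 - i)) A)
    (habstract : CanonicalLF.Derivable
      (.fam (Δ ++ CanonicalLF.Ctx.ofTypes Bs ++ Γ) A .type))
    (hΔ : CanonicalLF.Ctx.NF (CanonicalLF.Ctx.subst (CanonicalLF.inst Ns) Δ) Δ')
    (hA : CanonicalLF.Fam.NF
      (A.subst (CanonicalLF.ups (CanonicalLF.Ctx.numObj Δ) (CanonicalLF.inst Ns))) A')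
    (hinstance : CanonicalLF.Derivable (.fam (Δ' ++ Γ) A' .type)) :
    ∃ B' : CanonicalLF.Fam,
      CanonicalLF.Fam.NF (Bs[i].subst (CanonicalLF.inst (Ns.take i))) B' ∧
      CanonicalLF.Derivable (.obj Γ Ns[i] B') := by
  rw [List.append_assoc] at habstract
  refine hrigid.derivable (Γ := Γ) (Ns := Ns) hlen ?_ hiN hiB (fun y h₁ h₂ => ⟨h₁, h₂⟩) rfl
    (hΔ.red habstract.fam_ctx) habstract hinstance
    ((CanonicalLF.Fam.noLam_subst.2 habstract.fam_long.noLam).red_of_steps hA.1)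
  exact CanonicalLF.Obj.forall₂_of_getElem (by simpa using hlen) fun j h₁ h₂ => by
    simpa using hlong j h₁ (by simpa using h₂)
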